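/- For $n\in\mathbb N$ let $\mathbb M_n$ be the algebra of complex $n\times n$ matrices, $\mathbb M_n^+$ its positive semidefinite elements, $I_n$ the identity matrix, and $\|\cdot\|_\infty$ the operator norm. Let $\mathrm{OM}_{+,1}$ be the set of non-negative operator monotone functions $f$ on $[0,\infty)$ (that is, $0\le X\le Y$ implies $f(X)\le f(Y)$ for Hermitian matrices $X,Y$ of every size) with $f(1)=1$. For $f\in\mathrm{OM}_{+,1}$ and $X,Y\in\mathbb M_l^+$ the operator mean is $$X\,\sigma_f\,Y:=\lim_{\varepsilon\searrow0}X_\varepsilon^{1/2}f\bigl(X_\varepsilon^{-1/2}Y_\varepsilon X_\varepsilon^{-1/2}\bigr)X_\varepsilon^{1/2},\qquad X_\varepsilon:=X+\varepsilon I_l,\quad Y_\varepsilon:=Y+\varepsilon I_l .$$ For $X\in\mathbb M_l^+$ let $\lambda_1(X)\ge\dots\ge\lambda_l(X)$ be its eigenvalues in decreasing order, counted with multiplicities. **Proposition 4.1.** Let $l\ge1$, let $\Phi:\mathbb M_n\to\mathbb M_l$ and $\Psi:\mathbb M_m\to\mathbb M_l$ be positive linear maps (that is, linear maps sending positive semidefinite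 matrices to positive semidefinite matrices), and let $f\in\mathrm{OM}_{+,1}$ satisfy $f(x)^r\le f(x^r)$ for all $x\ge0$ and $r\ge1$. Then for every $A\in\mathbb M_n^+$, $B\in\mathbb M_m^+$ and every real $r\ge1$, the limits defining $\Phi(A^r)\,\sigma_f\,\Psi(B^r)$ and $\Phi(A)\,\sigma_f\,\Psi(B)$ exist and are positive semidefinite, and $$\bigl(\max\{\|\Phi(I_n)\|_\infty,\|\Psi(I_m)\|_\infty\}\bigr)^{r-1}\,\lambda_l\bigl(\Phi(A^r)\,\sigma_f\,\Psi(B^r)\bigr)\ \ge\ \lambda_l\bigl(\Phi(A)\,\sigma_f\,\Psi(B)\bigr)^r ,$$ with the convention $0^0=1$. -/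

import Mathlib

open Filter Topology
open scoped ComplexOrder

noncomputable section

/-- The real power `A ^ r` of a positive semidefinite matrix, by functional calculus. -/
def matPow {n : ℕ} (A : Matrix (Fin n) (Fin n) ℂ) (r : ℝ) : Matrix (Fin n) (Fin n) ℂ :=
  cfc (fun x : ℝ => x ^ r) A

/-- The class of non-negative operator monotone functions `f` on `[0, ∞)` with `f 1 = 1`.
Values of `f` at negative reals are irrelevant. The spectrum of a matrix is finite, so the
functional calculus `cfc f A` is the spectral one for every function `f`. -/
structure IsOMPlusOne (f : ℝ → ℝ) : Prop where
  nonneg : ∀ x : ℝ, 0 ≤ x → 0 ≤ f x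
  monotone : ∀ (n : ℕ) (A B : Matrix (Fin n) (Fin n) ℂ),
    A.PosSemidef → (B - A).PosSemidef → (cfc f B - cfc f A).PosSemidef
  map_one : f 1 = 1

/-- A linear map between matrix algebras is positive if it preserves positive
semidefiniteness. -/
def IsPositiveMap {n l : ℕ}
    (Φ : Matrix (Fin n) (Fin n) ℂ →ₗ[ℂ] Matrix (Fin l) (Fin l) ℂ) : Prop :=
  ∀ A : Matrix (Fin n) (Fin n) ℂ, A.PosSemidef → (Φ A).PosSemidef

/-- The operator norm of a matrix acting on Euclidean space. -/
def opNorm {l : ℕ} (X : Matrix (Fin l) (Fin l) ℂ) : ℝ :=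
  ‖Matrix.toEuclideanCLM (n := Fin l) (𝕜 := ℂ) X‖

/-- `A^{1/2} f(A^{-1/2} B A^{-1/2}) A^{1/2}`, meant for positive definite `A`. -/
def operatorMeanPos {l : ℕ} (f : ℝ → ℝ) (A B : Matrix (Fin l) (Fin l) ℂ) :
    Matrix (Fin l) (Fin l) ℂ :=
  matPow A (1 / 2) * cfc f (matPow A (-(1 / 2)) * B * matPow A (-(1 / 2))) * matPow A (1 / 2)

/-- `(A + ε I) σ_f (B + ε I)`. -/
def operatorMeanReg {l : ℕ} (f : ℝ → ℝ) (A B : Matrix (Fin l) (Fin l) ℂ) (ε : ℝ) :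
    Matrix (Fin l) (Fin l) ℂ :=
  operatorMeanPos f (A + (ε : ℂ) • (1 : Matrix (Fin l) (Fin l) ℂ))
    (B + (ε : ℂ) • (1 : Matrix (Fin l) (Fin l) ℂ))

/-- The operator mean `A σ_f B`, the limit of `(A + ε I) σ_f (B + ε I)` as `ε ↓ 0`. -/
def operatorMean {l : ℕ} (f : ℝ → ℝ) (A B : Matrix (Fin l) (Fin l) ℂ) :
    Matrix (Fin l) (Fin l) ℂ :=
  limUnder (𝓝[>] (0 : ℝ)) (operatorMeanReg f A B)

/-- The limit that defines `A σ_f B` exists. -/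
def OperatorMeanConverges {l : ℕ} (f : ℝ → ℝ) (A B : Matrix (Fin l) (Fin l) ℂ) : Prop :=
  Tendsto (operatorMeanReg f A B) (𝓝[>] (0 : ℝ)) (𝓝 (operatorMean f A B))

/-- The eigenvalues of a Hermitian matrix in decreasing order, counting multiplicities
(Mathlib's `eigenvalues₀` is antitone), indexed from `0`. -/
def eigenvalueDesc {l : ℕ} {X : Matrix (Fin l) (Fin l) ℂ} (hX : X.IsHermitian) (k : Fin l) : ℝ :=
  hX.eigenvalues₀ (Fin.cast (Fintype.card_fin l).symm k)

/-- The smallest eigenvalue `λ_l(X)` of a Hermitian `l × l` matrix, `l ≥ 1`. -/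
def lastEigenvalue {l : ℕ} (hl : 0 < l) {X : Matrix (Fin l) (Fin l) ℂ}
    (hX : X.IsHermitian) : ℝ :=
  eigenvalueDesc hX ⟨l - 1, Nat.sub_lt hl Nat.one_pos⟩

end

/-! For `c > 0`, `c ≤ λ_l(M)` means `c • 1 ≤ M`, so the claim is an implication between operator
inequalities, and every bound can be pushed through a jointly monotone, homogeneous mean.

Two inequalities for `1 ≤ r ≤ 2` carry it. Ando–Hiai: `1 ≤ X σ Y` implies `1 ≤ X^r σ Y^r`; this is
where `f(x)^r ≤ f(x^r)` enters. Jensen: `Φ(A)^r ≤ K^(r-1) Φ(A^r)` when `Φ(1) ≤ K`. Both rest on `(W*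
W)^r = W* (W W*)^(r-1) W`, which lowers the exponent into `[0, 1]`, where Löwner–Heinz applies.
Monotonicity of the mean then gives `c^r ≤ K^(r-1) (Φ(A^r) σ Ψ(B^r))`. The estimate composes with
itself, so repeated halving of `r` reaches every `r ≥ 1`.

Joint monotonicity comes from Hansen's inequality `C f(D) C ≤ f(C D C)` for contractions `0 ≤ C ≤
1`, proved by a unitary dilation. It also makes the regularized means decrease as `ε ↓ 0`, so the
limits exist. -/

/-! ### Functional calculus and order for complex matrices -/

section MatrixFunctionalCalculus

open Matrix
open scoped MatrixOrder

variable {ι κ : Type*} [Fintype ι] [DecidableEq ι] [Fintype κ] [DecidableEq κ]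

theorem Matrix.continuousOn_real_spectrum (f : ℝ → ℝ) (A : Matrix ι ι ℂ) :
    ContinuousOn f (spectrum ℝ A) :=
  Matrix.finite_real_spectrum.continuousOn f

theorem Polynomial.exists_eval_eq_on_finite {K : Type*} [Field K] {s : Set K} (hs : s.Finite)
    (f : K → K) : ∃ p : Polynomial K, ∀ x ∈ s, p.eval x = f x := by
  classical
  refine ⟨Lagrange.interpolate hs.toFinset id f, fun x hx => ?_⟩
  exact Lagrange.eval_interpolate_at_node (v := id) f (Set.injOn_id _) (by simpa using hx)

theorem Matrix.cfc_eq_aeval {A : Matrix ι ι ℂ} (hA : A.IsHermitian) {f : ℝ → ℝ}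
    {p : Polynomial ℝ} (h : ∀ x ∈ spectrum ℝ A, p.eval x = f x) :
    cfc f A = Polynomial.aeval A p := by
  rw [← cfc_polynomial p A hA]
  exact cfc_congr fun x hx => (h x hx).symm

/-- If `W` intertwines two Hermitian matrices, it intertwines their functional calculi. -/
theorem Matrix.cfc_mul_eq_mul_cfc {A : Matrix ι ι ℂ} {B : Matrix κ κ ℂ} {W : Matrix ι κ ℂ}
    (hA : A.IsHermitian) (hB : B.IsHermitian) (h : A * W = W * B) (f : ℝ → ℝ) :
    cfc f A * W = W * cfc f B := by
  -- A single polynomial interpolates `f` on both spectra, which reduces the claim to powers.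
  obtain ⟨p, hp⟩ := Polynomial.exists_eval_eq_on_finite
    ((Matrix.finite_real_spectrum (A := A)).union (Matrix.finite_real_spectrum (A := B))) f
  rw [Matrix.cfc_eq_aeval hA fun x hx => hp x (Or.inl hx),
    Matrix.cfc_eq_aeval hB fun x hx => hp x (Or.inr hx)]
  have hpow : ∀ k : ℕ, A ^ k * W = W * B ^ k := by
    intro k
    induction k with
    | zero => simp
    | succ k ih => rw [pow_succ, Matrix.mul_assoc, h, ← Matrix.mul_assoc, ih, Matrix.mul_assoc,
        ← pow_succ]
  simp only [Polynomial.aeval_eq_sum_range, Matrix.sum_mul, Matrix.mul_sum, Matrix.smul_mul,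
    Matrix.mul_smul, hpow]

theorem Matrix.isHermitian_cfc (f : ℝ → ℝ) (A : Matrix ι ι ℂ) : (cfc f A).IsHermitian :=
  (IsSelfAdjoint.cfc : IsSelfAdjoint (cfc f A))

theorem Matrix.cfc_self {A : Matrix ι ι ℂ} (hA : A.IsHermitian) :
    cfc (fun x : ℝ => x) A = A :=
  cfc_id' ℝ A hA

theorem Matrix.cfc_one_fun {A : Matrix ι ι ℂ} (hA : A.IsHermitian) :
    cfc (fun _ : ℝ => (1 : ℝ)) A = 1 :=
  cfc_const_one ℝ A hA

theorem Matrix.cfc_mul_cfc (f g : ℝ → ℝ) (A : Matrix ι ι ℂ) :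
    cfc f A * cfc g A = cfc (fun x => f x * g x) A :=
  (cfc_mul f g A (continuousOn_real_spectrum _ _) (continuousOn_real_spectrum _ _)).symm

theorem Matrix.cfc_le_cfc {f g : ℝ → ℝ} {A : Matrix ι ι ℂ}
    (h : ∀ x ∈ spectrum ℝ A, f x ≤ g x) : cfc f A ≤ cfc g A :=
  cfc_mono h (continuousOn_real_spectrum _ _) (continuousOn_real_spectrum _ _)

theorem Matrix.cfc_cfc (g f : ℝ → ℝ) {A : Matrix ι ι ℂ} (hA : A.IsHermitian) :
    cfc g (cfc f A) = cfc (fun x => g (f x)) A :=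
  (cfc_comp g f A hA ((Matrix.finite_real_spectrum.image f).continuousOn g)
    (continuousOn_real_spectrum _ _)).symm

theorem Matrix.cfc_real_smul (c : ℝ) (f : ℝ → ℝ) (A : Matrix ι ι ℂ) :
    cfc (fun x => c * f x) A = c • cfc f A := by
  simpa using cfc_smul c f A (continuousOn_real_spectrum _ _)

theorem Matrix.cfc_of_real_smul (c : ℝ) (f : ℝ → ℝ) {A : Matrix ι ι ℂ} (hA : A.IsHermitian) :
    cfc f (c • A) = cfc (fun x => f (c * x)) A := by
  have h : c • A = cfc (fun x : ℝ => c * x) A := by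
    rw [Matrix.cfc_real_smul c (fun x => x), Matrix.cfc_self hA]
  rw [h, Matrix.cfc_cfc _ _ hA]

theorem Matrix.PosDef.spectrum_pos {A : Matrix ι ι ℂ} (hA : A.PosDef) {x : ℝ}
    (hx : x ∈ spectrum ℝ A) : 0 < x := by
  rw [hA.isHermitian.spectrum_real_eq_range_eigenvalues] at hx
  obtain ⟨i, rfl⟩ := hx
  exact hA.eigenvalues_pos i

theorem Matrix.PosSemidef.spectrum_nonneg {A : Matrix ι ι ℂ} (hA : A.PosSemidef) {x : ℝ}
    (hx : x ∈ spectrum ℝ A) : 0 ≤ x :=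
  spectrum_nonneg_of_nonneg hA.nonneg hx

theorem Matrix.posSemidef_cfc {f : ℝ → ℝ} {A : Matrix ι ι ℂ}
    (h : ∀ x ∈ spectrum ℝ A, 0 ≤ f x) : (cfc f A).PosSemidef :=
  (cfc_nonneg h).posSemidef

theorem Matrix.posDef_cfc {f : ℝ → ℝ} {A : Matrix ι ι ℂ} (hA : A.IsHermitian)
    (h : ∀ x ∈ spectrum ℝ A, 0 < f x) : (cfc f A).PosDef := by
  refine (Matrix.posSemidef_cfc fun x hx => (h x hx).le).posDef_iff_isUnit.2 ?_
  exact (isUnit_cfc_iff f A (continuousOn_real_spectrum _ _) hA).2 fun x hx => (h x hx).ne'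

theorem Matrix.conjTranspose_mul_mul_le {m n : Type*} [Fintype m] [Finite n]
    {A B : Matrix m m ℂ} (h : A ≤ B) (W : Matrix m n ℂ) :
    Wᴴ * A * W ≤ Wᴴ * B * W := by
  rw [Matrix.le_iff] at h ⊢
  simpa [Matrix.mul_sub, Matrix.sub_mul] using h.conjTranspose_mul_mul_same W

/-- Holds because `W` intertwines `W * Wᴴ` and `Wᴴ * W`. -/
theorem Matrix.cfc_mul_self_conjTranspose {W : Matrix ι κ ℂ} (g : ℝ → ℝ) :
    cfc (fun x => x * g x) (Wᴴ * W) = Wᴴ * cfc g (W * Wᴴ) * W := by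
  have hB : (Wᴴ * W).IsHermitian := isHermitian_conjTranspose_mul_self W
  have hA : (W * Wᴴ).IsHermitian := isHermitian_mul_conjTranspose_self W
  rw [← Matrix.cfc_mul_cfc (fun x => x), Matrix.cfc_self hB, Matrix.mul_assoc Wᴴ,
    Matrix.mul_assoc Wᴴ, Matrix.cfc_mul_eq_mul_cfc hA hB (Matrix.mul_assoc _ _ _)]

theorem Real.rpow_eq_mul_rpow_sub_one {x r : ℝ} (hx : 0 ≤ x) (hr : 1 ≤ r) :
    x ^ r = x * x ^ (r - 1) := by
  conv_lhs => rw [show r = 1 + (r - 1) by ring]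
  rw [Real.rpow_add' hx (by linarith), Real.rpow_one]

/-- `(W* W)^r = W* (W W*)^{r-1} W`. -/
theorem Matrix.cfc_rpow_conjTranspose_mul_self (W : Matrix ι κ ℂ) {r : ℝ} (hr : 1 ≤ r) :
    cfc (fun x : ℝ => x ^ r) (Wᴴ * W) = Wᴴ * cfc (fun x : ℝ => x ^ (r - 1)) (W * Wᴴ) * W := by
  rw [← Matrix.cfc_mul_self_conjTranspose]
  refine cfc_congr fun x hx => ?_
  exact Real.rpow_eq_mul_rpow_sub_one
    ((posSemidef_conjTranspose_mul_self W).spectrum_nonneg hx) hr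

/-- The Löwner–Heinz inequality. -/
theorem Matrix.cfc_rpow_le_cfc_rpow {A B : Matrix ι ι ℂ} (hA : A.PosSemidef) (h : A ≤ B)
    {p : ℝ} (hp : p ∈ Set.Icc (0 : ℝ) 1) :
    cfc (fun x : ℝ => x ^ p) A ≤ cfc (fun x : ℝ => x ^ p) B := by
  open scoped Matrix.Norms.L2Operator in
  have := CFC.rpow_le_rpow hp h
  rwa [CFC.rpow_eq_cfc_real hA.nonneg, CFC.rpow_eq_cfc_real (hA.nonneg.trans h)] at this

theorem Matrix.smul_one_le_iff {A : Matrix ι ι ℂ} (hA : A.IsHermitian) {c : ℝ} :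
    c • (1 : Matrix ι ι ℂ) ≤ A ↔ ∀ x ∈ spectrum ℝ A, c ≤ x := by
  rw [← Algebra.algebraMap_eq_smul_one]
  exact algebraMap_le_iff_le_spectrum hA

theorem Matrix.le_smul_one_iff {A : Matrix ι ι ℂ} (hA : A.IsHermitian) {c : ℝ} :
    A ≤ c • (1 : Matrix ι ι ℂ) ↔ ∀ x ∈ spectrum ℝ A, x ≤ c := by
  rw [← Algebra.algebraMap_eq_smul_one]
  exact le_algebraMap_iff_spectrum_le hA

/-- If `V* V ≤ K` then `V V* ≤ K`. -/
theorem Matrix.mul_conjTranspose_le_smul_one {V : Matrix ι κ ℂ} {K : ℝ} (hK : 0 < K)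
    (h : Vᴴ * V ≤ K • (1 : Matrix κ κ ℂ)) : V * Vᴴ ≤ K • (1 : Matrix ι ι ℂ) := by
  have hd : (K • (1 : Matrix ι ι ℂ)).PosDef := by
    simpa using (Matrix.PosDef.one (n := ι) (R := ℂ)).smul hK
  have hu : IsUnit (K • (1 : Matrix ι ι ℂ)) := hd.isUnit
  let _ := hu.invertible
  have hinv : (K • (1 : Matrix ι ι ℂ))⁻¹ = K⁻¹ • 1 :=
    Matrix.inv_eq_left_inv (by simp [smul_smul, hK.ne'])
  -- Hypothesis and conclusion are, up to the factor `K`, the two Schur complement conditions for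
  -- positivity of the block matrix with rows `(K, V)` and `(Vᴴ, 1)`.
  have h2 := (Matrix.PosDef.fromBlocks₁₁ V (1 : Matrix κ κ ℂ) hd).2 (by
    rw [hinv]
    have := (Matrix.le_iff.1 h).smul (inv_nonneg.2 hK.le)
    simpa [smul_sub, smul_smul, hK.ne'] using this)
  have h1 : (1 : Matrix κ κ ℂ).PosDef := Matrix.PosDef.one
  let _ := h1.isUnit.invertible
  have := (Matrix.PosDef.fromBlocks₂₂ (K • (1 : Matrix ι ι ℂ)) V h1).1 h2
  rw [Matrix.le_iff]
  simpa using this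

/-- Each coordinate embedding intertwines the block matrix with one of its blocks, and the two
embeddings side by side form the identity. -/
theorem Matrix.cfc_fromBlocks_diagonal {A : Matrix ι ι ℂ} {B : Matrix κ κ ℂ}
    (hA : A.IsHermitian) (hB : B.IsHermitian) (f : ℝ → ℝ) :
    cfc f (fromBlocks A 0 0 B) = fromBlocks (cfc f A) 0 0 (cfc f B) := by
  have hAB : (fromBlocks A 0 0 B).IsHermitian :=
    Matrix.IsHermitian.fromBlocks hA (by simp) hB
  have h1 := Matrix.cfc_mul_eq_mul_cfc (W := fromRows 1 0) hAB hA
    (by simp [fromBlocks_mul_fromRows, fromRows_mul]) f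
  have h2 := Matrix.cfc_mul_eq_mul_cfc (W := fromRows 0 1) hAB hB
    (by simp [fromBlocks_mul_fromRows, fromRows_mul]) f
  have := congrArg₂ fromCols h1 h2
  rw [← mul_fromCols] at this
  have e : fromCols (fromRows 1 0) (fromRows 0 1) = (1 : Matrix (ι ⊕ κ) (ι ⊕ κ) ℂ) := by
    ext (i | i) (j | j) <;> simp [Matrix.one_apply]
  rw [e, Matrix.mul_one] at this
  rw [this]
  ext (i | i) (j | j) <;> simp [fromRows_mul]

end MatrixFunctionalCalculus

/-! ### Operator monotone functions and Hansen's inequality -/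

section Hansen

open Matrix
open scoped MatrixOrder

variable {ι : Type*} [Fintype ι] [DecidableEq ι]

theorem Matrix.cfc_submatrix_equiv {κ : Type*} [Fintype κ] [DecidableEq κ] (e : κ ≃ ι)
    {A : Matrix ι ι ℂ} (hA : A.IsHermitian) (f : ℝ → ℝ) :
    cfc f (A.submatrix e e) = (cfc f A).submatrix e e := by
  have hl : ∀ M : Matrix ι ι ℂ, M * (1 : Matrix ι ι ℂ).submatrix id e = M.submatrix id e := by
    intro M
    simpa using Matrix.submatrix_mul_equiv M 1 id (Equiv.refl ι) e
  have hr : ∀ M : Matrix κ κ ℂ, (1 : Matrix ι ι ℂ).submatrix id e * M = M.submatrix e.symm id := by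
    intro M
    simpa using Matrix.submatrix_mul_equiv (1 : Matrix ι ι ℂ) (M.submatrix e.symm id) id e id
  have h := Matrix.cfc_mul_eq_mul_cfc (W := (1 : Matrix ι ι ℂ).submatrix id e) hA (hA.submatrix e)
    (by rw [hl, hr]; ext i j; simp) f
  rw [hl, hr] at h
  have h2 := congrArg (fun M : Matrix ι κ ℂ => M.submatrix e id) h
  simpa using h2.symm

/-- Reindexing frees monotonicity from `Fin n`, so that it applies to block matrices over `ι ⊕ ι`.
-/
theorem IsOMPlusOne.cfc_le_cfc {f : ℝ → ℝ} (hf : IsOMPlusOne f) {A B : Matrix ι ι ℂ}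
    (hA : A.PosSemidef) (h : A ≤ B) : cfc f A ≤ cfc f B := by
  let e : Fin (Fintype.card ι) ≃ ι := (Fintype.equivFin ι).symm
  have hB : B.PosSemidef := (hA.nonneg.trans h).posSemidef
  have := hf.monotone _ (A.submatrix e e) (B.submatrix e e) (hA.submatrix e)
    ((Matrix.le_iff.1 h).submatrix e)
  rw [Matrix.cfc_submatrix_equiv e hA.isHermitian, Matrix.cfc_submatrix_equiv e hB.isHermitian]
    at this
  have h2 := this.submatrix e.symm
  rw [Matrix.le_iff]
  simpa [Matrix.submatrix_sub] using h2

/-- With `E = √(1 - C²)`, the contraction `C` is a corner of the self-adjoint unitary `U` with rows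
`(C, E)` and `(E, -C)`, so `C D C` is a corner of `U (D ⊕ 0) U`. The weights `1 + δ` and `1 + δ⁻¹`
absorb the off-diagonal blocks into a block-diagonal majorant, on which `f` acts blockwise. -/
theorem IsOMPlusOne.conj_cfc_le_of_dilation {f : ℝ → ℝ} (hf : IsOMPlusOne f)
    {C D : Matrix ι ι ℂ} (hC : C.PosSemidef) (hC1 : C ≤ 1) (hD : D.PosSemidef)
    {δ : ℝ} (hδ : 0 < δ) :
    C * cfc f D * C ≤ cfc f ((1 + δ) • (C * D * C)) := by
  have hspec : ∀ x ∈ spectrum ℝ C, 0 ≤ x ∧ x ≤ 1 := fun x hx =>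
    ⟨hC.spectrum_nonneg hx,
      (Matrix.le_smul_one_iff (c := 1) hC.isHermitian).1 (by simpa using hC1) x hx⟩
  set E : Matrix ι ι ℂ := cfc (fun x : ℝ => √(1 - x ^ 2)) C with hE
  have hEH : Eᴴ = E := Matrix.isHermitian_cfc _ _
  have hCH : Cᴴ = C := hC.isHermitian
  have hCE : C * E = E * C := by
    have h1 : cfc (fun x : ℝ => x) C * E = E * cfc (fun x : ℝ => x) C := by
      rw [hE, Matrix.cfc_mul_cfc, Matrix.cfc_mul_cfc]
      exact cfc_congr fun x _ => mul_comm _ _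
    rwa [Matrix.cfc_self hC.isHermitian] at h1
  have hsq : C * C + E * E = 1 := by
    have h1 : cfc (fun x : ℝ => x) C * cfc (fun x : ℝ => x) C + E * E = 1 := by
      rw [hE, Matrix.cfc_mul_cfc, Matrix.cfc_mul_cfc,
        ← cfc_add _ _ _ (continuousOn_real_spectrum _ _) (continuousOn_real_spectrum _ _),
        ← cfc_one ℝ C hC.isHermitian]
      refine cfc_congr fun x hx => ?_
      obtain ⟨h0, h1⟩ := hspec x hx
      simp only [Pi.one_apply]
      rw [Real.mul_self_sqrt (by nlinarith)]
      ring
    rwa [Matrix.cfc_self hC.isHermitian] at h1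
  have hsq' : E * E + C * C = 1 := by rw [add_comm, hsq]
  set U : Matrix (ι ⊕ ι) (ι ⊕ ι) ℂ := fromBlocks C E E (-C) with hU
  have hUH : Uᴴ = U := by simp [hU, fromBlocks_conjTranspose, hEH, hCH]
  have hUU : U * U = 1 := by
    simp [hU, fromBlocks_multiply, hsq, hsq', hCE]
  set X : Matrix (ι ⊕ ι) (ι ⊕ ι) ℂ := fromBlocks D 0 0 0 with hX
  have hXpsd : X.PosSemidef := by
    have := hD.conjTranspose_mul_mul_same (fromCols (1 : Matrix ι ι ℂ) (0 : Matrix ι ι ℂ))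
    convert this using 1
    ext (i | i) (j | j) <;> simp [hX, conjTranspose_fromCols_eq_fromRows_conjTranspose,
      fromRows_mul]
  have hUXU : (U * X * U).PosSemidef := by
    simpa [hUH] using hXpsd.conjTranspose_mul_mul_same U
  set Y : Matrix (ι ⊕ ι) (ι ⊕ ι) ℂ :=
    fromBlocks ((1 + δ) • (C * D * C)) 0 0 ((1 + δ⁻¹) • (E * D * E)) with hY
  have hCDC : (C * D * C).PosSemidef := by
    simpa [hCH] using hD.conjTranspose_mul_mul_same C
  have hEDE : (E * D * E).PosSemidef := by
    simpa [hEH] using hD.conjTranspose_mul_mul_same E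
  have hle : U * X * U ≤ Y := by
    rw [Matrix.le_iff]
    -- The gap has blocks `δ C D C`, `-C D E`, `-E D C`, `δ⁻¹ E D E`: a perfect square built from
    -- this row.
    set R : Matrix (ι ⊕ ι) (ι ⊕ ι) ℂ := fromBlocks (√δ • C) (-((√δ)⁻¹ • E)) 0 0 with hR
    have hRXR := hXpsd.conjTranspose_mul_mul_same R
    suffices e : Y - U * X * U = Rᴴ * X * R by rwa [e]
    have hsub : ∀ A B C D A' B' C' D' : Matrix ι ι ℂ, fromBlocks A B C D -
        fromBlocks A' B' C' D' = fromBlocks (A - A') (B - B') (C - C') (D - D') := by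
      intros; ext (i | i) (j | j) <;> rfl
    have h1 : √δ * √δ = δ := Real.mul_self_sqrt hδ.le
    have h2 : √δ ≠ 0 := (Real.sqrt_pos.2 hδ).ne'
    simp [hU, hX, hY, hR, fromBlocks_multiply, fromBlocks_conjTranspose, hCH, hEH,
      smul_smul, h1, h2, hsub, add_smul, ← mul_inv]
  have hmono := hf.cfc_le_cfc hUXU hle
  have hfU : cfc f (U * X * U) = U * cfc f X * U := by
    have := Matrix.cfc_mul_eq_mul_cfc (W := U) hXpsd.isHermitian hUXU.isHermitian
      (by simp only [← Matrix.mul_assoc, hUU, Matrix.one_mul]) f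
    rw [Matrix.mul_assoc U (cfc f X), this, ← Matrix.mul_assoc, hUU, Matrix.one_mul]
  have hfX : cfc f X = fromBlocks (cfc f D) 0 0 (cfc f 0) :=
    Matrix.cfc_fromBlocks_diagonal hD.isHermitian (by simp) f
  have hfY : cfc f Y = fromBlocks (cfc f ((1 + δ) • (C * D * C))) 0 0
      (cfc f ((1 + δ⁻¹) • (E * D * E))) :=
    Matrix.cfc_fromBlocks_diagonal (hCDC.smul (by positivity)).isHermitian
      (hEDE.smul (by positivity)).isHermitian f
  rw [hfU, hfX, hfY] at hmono
  -- The upper left corner also contains `E f(0) E`, which can be dropped because `f 0 ≥ 0`.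
  have hblock := (Matrix.le_iff.1 hmono).submatrix Sum.inl
  have h0 : (E * cfc f (0 : Matrix ι ι ℂ) * E).PosSemidef := by
    have : (cfc f (0 : Matrix ι ι ℂ)).PosSemidef := Matrix.posSemidef_cfc fun x hx =>
      hf.nonneg x (Matrix.PosSemidef.zero.spectrum_nonneg hx)
    simpa [hEH] using this.conjTranspose_mul_mul_same E
  have hblock' : C * cfc f D * C + E * cfc f (0 : Matrix ι ι ℂ) * E
      ≤ cfc f ((1 + δ) • (C * D * C)) := by
    rw [Matrix.le_iff]
    convert hblock using 1
    ext i j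
    simp [hU, fromBlocks_multiply]
  exact (le_add_of_nonneg_right h0.nonneg).trans hblock'

theorem cfc_real_smul_one (f : ℝ → ℝ) (c : ℝ) :
    cfc f (c • (1 : Matrix ι ι ℂ)) = f c • (1 : Matrix ι ι ℂ) := by
  rw [← Algebra.algebraMap_eq_smul_one, ← Algebra.algebraMap_eq_smul_one]
  exact cfc_algebraMap c f

theorem Matrix.smul_one_le_smul_one_iff {m : Type*} [DecidableEq m] [Nonempty m] {a b : ℝ} :
    a • (1 : Matrix m m ℂ) ≤ b • (1 : Matrix m m ℂ) ↔ a ≤ b := by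
  rw [Matrix.le_iff, ← sub_smul]
  constructor
  · intro h
    have := h.diag_nonneg (i := Classical.arbitrary m)
    simpa [Complex.le_def] using this
  · intro h
    exact Matrix.PosSemidef.one.smul (sub_nonneg.2 h)

/-- The `1 × 1` dilation inequality with `C² = c / (1 + δ)`: the factor `1 + δ` cancels inside `f`
and survives only outside, so `δ → 0` needs no continuity of `f`. -/
theorem IsOMPlusOne.mul_le_map_mul {f : ℝ → ℝ} (hf : IsOMPlusOne f) {c y : ℝ}
    (hc : 0 ≤ c) (hc1 : c ≤ 1) (hy : 0 ≤ y) : c * f y ≤ f (c * y) := by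
  have key : ∀ δ : ℝ, 0 < δ → c * f y ≤ (1 + δ) * f (c * y) := by
    intro δ hδ
    have hs : 0 ≤ c / (1 + δ) := by positivity
    have h := hf.conj_cfc_le_of_dilation (ι := Fin 1) (C := √(c / (1 + δ)) • 1) (D := y • 1)
      (Matrix.PosSemidef.one.smul (Real.sqrt_nonneg _)) (by
        have : √(c / (1 + δ)) ≤ 1 := by
          rw [Real.sqrt_le_one]
          rw [div_le_one (by positivity)]; linarith
        simpa using (Matrix.smul_one_le_smul_one_iff (m := Fin 1)).2 this)
      (Matrix.PosSemidef.one.smul hy) hδ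
    simp only [cfc_real_smul_one, Matrix.smul_mul, Matrix.mul_smul, Matrix.one_mul, smul_smul,
      Matrix.smul_one_le_smul_one_iff] at h
    have e1 : √(c / (1 + δ)) * (√(c / (1 + δ)) * f y) = c / (1 + δ) * f y := by
      rw [← mul_assoc, Real.mul_self_sqrt hs]
    have e2 : (1 + δ) * (√(c / (1 + δ)) * (√(c / (1 + δ)) * y)) = c * y := by
      rw [← mul_assoc (√_), Real.mul_self_sqrt hs]; field_simp
    have e3 : √(c / (1 + δ)) * (f y * √(c / (1 + δ))) = c / (1 + δ) * f y := by
      rw [← e1]; ring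
    have e4 : (1 + δ) * (√(c / (1 + δ)) * (y * √(c / (1 + δ)))) = c * y := by
      rw [← e2]; ring
    simp only [e3, e4] at h
    rw [div_mul_eq_mul_div, div_le_iff₀ (by positivity)] at h
    linarith
  have hlim : Tendsto (fun δ : ℝ => (1 + δ) * f (c * y)) (𝓝[>] 0) (𝓝 ((1 + 0) * f (c * y))) :=
    ((continuous_const.add continuous_id).mul continuous_const).continuousWithinAt
  have := ge_of_tendsto hlim (by filter_upwards [self_mem_nhdsWithin] with δ hδ using key δ hδ)
  simpa using this

theorem IsOMPlusOne.map_mul_le {f : ℝ → ℝ} (hf : IsOMPlusOne f) {c y : ℝ}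
    (hc : 1 ≤ c) (hy : 0 ≤ y) : f (c * y) ≤ c * f y := by
  have h0 : 0 < c := by linarith
  have := hf.mul_le_map_mul (inv_nonneg.2 h0.le) (inv_le_one_of_one_le₀ hc)
    (mul_nonneg h0.le hy)
  rw [inv_mul_cancel_left₀ h0.ne', inv_mul_le_iff₀ h0] at this
  exact this

theorem IsOMPlusOne.pos {f : ℝ → ℝ} (hf : IsOMPlusOne f) {x : ℝ} (hx : 0 < x) : 0 < f x := by
  rcases le_total x 1 with h | h
  · have := hf.mul_le_map_mul hx.le h zero_le_one
    rw [hf.map_one, mul_one] at this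
    linarith
  · have h1 := hf.mul_le_map_mul (inv_nonneg.2 hx.le) (inv_le_one_of_one_le₀ h) hx.le
    rw [inv_mul_cancel₀ hx.ne', hf.map_one] at h1
    by_contra h2
    have : f x = 0 := le_antisymm (not_lt.1 h2) (hf.nonneg x hx.le)
    have h3 := hf.cfc_le_cfc (ι := Fin 1) (A := (1 : ℝ) • 1) (B := x • 1)
      (Matrix.PosSemidef.one.smul zero_le_one) (Matrix.smul_one_le_smul_one_iff.2 h)
    rw [cfc_real_smul_one, cfc_real_smul_one, Matrix.smul_one_le_smul_one_iff, hf.map_one] at h3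
    linarith

theorem Matrix.isClosed_posSemidef : IsClosed {M : Matrix ι ι ℂ | M.PosSemidef} := by
  open scoped Matrix.Norms.L2Operator in
  have : IsClosed {M : Matrix ι ι ℂ | 0 ≤ M} := CStarAlgebra.isClosed_nonneg
  simpa [Matrix.nonneg_iff_posSemidef] using this

theorem Matrix.le_of_forall_pos_le_add_smul {A B H : Matrix ι ι ℂ}
    (h : ∀ δ : ℝ, 0 < δ → A ≤ B + δ • H) : A ≤ B := by
  have hlim : Tendsto (fun δ : ℝ => B + δ • H - A) (𝓝[>] 0) (𝓝 (B + (0 : ℝ) • H - A)) := by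
    have : Continuous fun δ : ℝ => B + δ • H - A := by fun_prop
    exact this.continuousWithinAt
  have := Matrix.isClosed_posSemidef.mem_of_tendsto hlim (by
    filter_upwards [self_mem_nhdsWithin] with δ hδ using Matrix.le_iff.1 (h δ hδ))
  simpa [Matrix.le_iff] using this

/-- Hansen's inequality. -/
theorem IsOMPlusOne.conj_cfc_le {f : ℝ → ℝ} (hf : IsOMPlusOne f)
    {C D : Matrix ι ι ℂ} (hC : C.PosSemidef) (hC1 : C ≤ 1) (hD : D.PosSemidef) :
    C * cfc f D * C ≤ cfc f (C * D * C) := by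
  have hCDC : (C * D * C).PosSemidef := by
    simpa [hC.isHermitian.eq] using hD.conjTranspose_mul_mul_same C
  -- The bound `f((1 + δ) x) ≤ (1 + δ) f(x)` moves `δ` outside `f`; the error is then `δ f(C D C)`.
  refine Matrix.le_of_forall_pos_le_add_smul (H := cfc f (C * D * C)) fun δ hδ => ?_
  refine (hf.conj_cfc_le_of_dilation hC hC1 hD hδ).trans ?_
  rw [Matrix.cfc_of_real_smul _ _ hCDC.isHermitian]
  calc _ ≤ cfc (fun x => (1 + δ) * f x) (C * D * C) :=
        Matrix.cfc_le_cfc fun x hx => hf.map_mul_le (by linarith) (hCDC.spectrum_nonneg hx)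
    _ = _ := by rw [Matrix.cfc_real_smul, add_smul, one_smul]

end Hansen

/-! ### Operator means: congruence, monotonicity, convergence -/

section OperatorMean

open Matrix
open scoped MatrixOrder

variable {l : ℕ} {f : ℝ → ℝ}

theorem isHermitian_matPow (X : Matrix (Fin l) (Fin l) ℂ) (r : ℝ) : (matPow X r).IsHermitian :=
  Matrix.isHermitian_cfc _ _

theorem posSemidef_matPow {X : Matrix (Fin l) (Fin l) ℂ} (hX : X.PosSemidef) (r : ℝ) :
    (matPow X r).PosSemidef :=
  Matrix.posSemidef_cfc fun _ hx => Real.rpow_nonneg (hX.spectrum_nonneg hx) r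

theorem posDef_matPow {X : Matrix (Fin l) (Fin l) ℂ} (hX : X.PosDef) (r : ℝ) :
    (matPow X r).PosDef :=
  Matrix.posDef_cfc hX.isHermitian fun _ hx => Real.rpow_pos_of_pos (hX.spectrum_pos hx) r

theorem matPow_mul_matPow {X : Matrix (Fin l) (Fin l) ℂ} (hX : X.PosDef) (r s : ℝ) :
    matPow X r * matPow X s = matPow X (r + s) := by
  rw [matPow, matPow, Matrix.cfc_mul_cfc]
  exact cfc_congr fun x hx => (Real.rpow_add (hX.spectrum_pos hx) r s).symm

theorem matPow_zero {X : Matrix (Fin l) (Fin l) ℂ} (hX : X.IsHermitian) : matPow X 0 = 1 := by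
  simp only [matPow, Real.rpow_zero]
  exact Matrix.cfc_one_fun hX

theorem matPow_one {X : Matrix (Fin l) (Fin l) ℂ} (hX : X.IsHermitian) : matPow X 1 = X := by
  simp only [matPow, Real.rpow_one]
  exact Matrix.cfc_self hX

theorem matPow_matPow {X : Matrix (Fin l) (Fin l) ℂ} (hX : X.PosSemidef) (r s : ℝ) :
    matPow (matPow X r) s = matPow X (r * s) := by
  rw [matPow, matPow, Matrix.cfc_cfc _ _ hX.isHermitian]
  exact cfc_congr fun x hx => (Real.rpow_mul (hX.spectrum_nonneg hx) r s).symm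

theorem matPow_half_mul_self {X : Matrix (Fin l) (Fin l) ℂ} (hX : X.PosDef) :
    matPow X (1 / 2) * matPow X (1 / 2) = X := by
  rw [matPow_mul_matPow hX]
  norm_num [matPow_one hX.isHermitian]

theorem matPow_half_mul_neg_half {X : Matrix (Fin l) (Fin l) ℂ} (hX : X.PosDef) :
    matPow X (1 / 2) * matPow X (-(1 / 2)) = 1 := by
  rw [matPow_mul_matPow hX, add_neg_cancel, matPow_zero hX.isHermitian]

theorem matPow_neg_half_mul_half {X : Matrix (Fin l) (Fin l) ℂ} (hX : X.PosDef) :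
    matPow X (-(1 / 2)) * matPow X (1 / 2) = 1 := by
  rw [matPow_mul_matPow hX, neg_add_cancel, matPow_zero hX.isHermitian]

theorem matPow_half_conj_neg_half_conj {X : Matrix (Fin l) (Fin l) ℂ} (hX : X.PosDef)
    (Y : Matrix (Fin l) (Fin l) ℂ) :
    matPow X (1 / 2) * (matPow X (-(1 / 2)) * Y * matPow X (-(1 / 2))) * matPow X (1 / 2) = Y := by
  calc _ = matPow X (1 / 2) * matPow X (-(1 / 2)) * Y *
        (matPow X (-(1 / 2)) * matPow X (1 / 2)) := by simp only [Matrix.mul_assoc]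
    _ = Y := by
      rw [matPow_half_mul_neg_half hX, matPow_neg_half_mul_half hX, Matrix.one_mul, Matrix.mul_one]

theorem Matrix.PosDef.mono {X Y : Matrix (Fin l) (Fin l) ℂ} (hX : X.PosDef) (h : X ≤ Y) :
    Y.PosDef := by
  have := hX.add_posSemidef (Matrix.le_iff.1 h)
  simpa using this

theorem Matrix.isHermitian_mul_mul_of_isHermitian {R Y : Matrix (Fin l) (Fin l) ℂ}
    (hR : R.IsHermitian) (hY : Y.IsHermitian) : (R * Y * R).IsHermitian := by
  simpa [hR.eq] using isHermitian_conjTranspose_mul_mul R hY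

theorem Matrix.PosSemidef.mul_mul_of_isHermitian {R Y : Matrix (Fin l) (Fin l) ℂ}
    (hY : Y.PosSemidef) (hR : R.IsHermitian) : (R * Y * R).PosSemidef := by
  simpa [hR.eq] using hY.conjTranspose_mul_mul_same R

theorem Matrix.mul_mul_le_of_isHermitian {R Y Z : Matrix (Fin l) (Fin l) ℂ}
    (h : Y ≤ Z) (hR : R.IsHermitian) : R * Y * R ≤ R * Z * R := by
  simpa [hR.eq] using Matrix.conjTranspose_mul_mul_le h R

/-- The operator mean computed from an arbitrary invertible factor `T` of its first argument. -/
theorem operatorMeanPos_conj {T Z : Matrix (Fin l) (Fin l) ℂ} (hT : IsUnit T)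
    (hZ : Z.IsHermitian) :
    operatorMeanPos f (Tᴴ * T) (Tᴴ * Z * T) = Tᴴ * cfc f Z * T := by
  have hX : (Tᴴ * T).PosDef :=
    (posSemidef_conjTranspose_mul_self T).posDef_iff_isUnit.2 (hT.star.mul hT)
  set X := Tᴴ * T with hXdef
  set S := matPow X (1 / 2) with hS
  set R := matPow X (-(1 / 2)) with hR
  have hRH : Rᴴ = R := isHermitian_matPow X _
  have hSS : S * S = X := matPow_half_mul_self hX
  have hSR : S * R = 1 := matPow_half_mul_neg_half hX
  have hRS : R * S = 1 := matPow_neg_half_mul_half hX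
  -- `W = T X^(-1/2)` is the unitary factor in the polar decomposition of `T`.
  set W := T * R with hW
  have hWW : Wᴴ * W = 1 := by
    calc Wᴴ * W = R * X * R := by simp [hW, hRH, hXdef, Matrix.mul_assoc]
      _ = (R * S) * (S * R) := by rw [← hSS]; simp only [Matrix.mul_assoc]
      _ = 1 := by rw [hRS, hSR, Matrix.one_mul]
  have hWW' : W * Wᴴ = 1 := mul_eq_one_comm.1 hWW
  have hinner : R * (Tᴴ * Z * T) * R = Wᴴ * Z * W := by
    simp [hW, hRH, Matrix.mul_assoc]
  have hcfc : cfc f (Wᴴ * Z * W) = Wᴴ * cfc f Z * W := by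
    have := Matrix.cfc_mul_eq_mul_cfc (W := W) hZ (isHermitian_conjTranspose_mul_mul W hZ)
      (by simp only [← Matrix.mul_assoc, hWW', Matrix.one_mul]) f
    rw [Matrix.mul_assoc Wᴴ (cfc f Z), this, ← Matrix.mul_assoc Wᴴ W, hWW, Matrix.one_mul]
  have hSW : S * Wᴴ = Tᴴ := by
    rw [hW, conjTranspose_mul, hRH, ← Matrix.mul_assoc, hSR, Matrix.one_mul]
  have hWS : W * S = T := by rw [hW, Matrix.mul_assoc, hRS, Matrix.mul_one]
  rw [operatorMeanPos, ← hS, ← hR, hinner, hcfc]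
  calc S * (Wᴴ * cfc f Z * W) * S = (S * Wᴴ) * cfc f Z * (W * S) := by
        simp only [Matrix.mul_assoc]
    _ = _ := by rw [hSW, hWS]

theorem operatorMeanPos_smul {X Y : Matrix (Fin l) (Fin l) ℂ} (hX : X.PosDef)
    (hY : Y.IsHermitian) {c : ℝ} (hc : 0 < c) :
    operatorMeanPos f (c • X) (c • Y) = c • operatorMeanPos f X Y := by
  set S := matPow X (1 / 2) with hS
  set R := matPow X (-(1 / 2)) with hR
  have hSH : Sᴴ = S := isHermitian_matPow X _
  have hcc : √c * √c = c := Real.mul_self_sqrt hc.le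
  have hu : IsUnit (√c • S) :=
    ((posDef_matPow hX (1 / 2)).smul (Real.sqrt_pos.2 hc)).isUnit
  have h := operatorMeanPos_conj (f := f) hu
    (Matrix.isHermitian_mul_mul_of_isHermitian (isHermitian_matPow X (-(1 / 2))) hY)
  simp only [conjTranspose_smul, star_trivial, hSH, Matrix.smul_mul, Matrix.mul_smul, smul_smul,
    hcc, ← hR] at h
  rw [matPow_half_mul_self hX, matPow_half_conj_neg_half_conj hX Y] at h
  rw [h]
  rfl

theorem IsOMPlusOne.posSemidef_operatorMeanPos (hf : IsOMPlusOne f)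
    {X Y : Matrix (Fin l) (Fin l) ℂ} (hY : Y.PosSemidef) :
    (operatorMeanPos f X Y).PosSemidef := by
  refine (Matrix.posSemidef_cfc fun x hx => hf.nonneg x ?_).mul_mul_of_isHermitian
    (isHermitian_matPow X _)
  exact (hY.mul_mul_of_isHermitian (isHermitian_matPow X _)).spectrum_nonneg hx

/-- Operator means are jointly monotone. -/
theorem IsOMPlusOne.operatorMeanPos_mono (hf : IsOMPlusOne f)
    {X X' Y Y' : Matrix (Fin l) (Fin l) ℂ} (hX : X.PosDef) (hXX' : X ≤ X')
    (hY : Y.PosSemidef) (hYY' : Y ≤ Y') :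
    operatorMeanPos f X Y ≤ operatorMeanPos f X' Y' := by
  have hX' : X'.PosDef := hX.mono hXX'
  set S := matPow X' (1 / 2) with hS
  set R := matPow X' (-(1 / 2)) with hR
  have hSH : S.IsHermitian := isHermitian_matPow X' _
  have hRH : R.IsHermitian := isHermitian_matPow X' _
  have hSR : S * R = 1 := matPow_half_mul_neg_half hX'
  have hRS : R * S = 1 := matPow_neg_half_mul_half hX'
  have hP : (R * X * R).PosDef := by
    refine (hX.posSemidef.mul_mul_of_isHermitian hRH).posDef_iff_isUnit.2 ?_
    have hRu : IsUnit R := (posDef_matPow hX' _).isUnit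
    exact (hRu.mul hX.isUnit).mul hRu
  have hP1 : R * X * R ≤ 1 := by
    refine (Matrix.mul_mul_le_of_isHermitian hXX' hRH).trans_eq ?_
    rw [← matPow_half_mul_self hX', ← hS, ← Matrix.mul_assoc, hRS, Matrix.one_mul, hSR]
  -- Since `P ≤ 1`, `C = P^(1/2)` is a contraction. With `T = C S`, `X = T* T` and `Y = T* D T`, so
  -- the mean of `X` and `Y` is `S C f(D) C S`, and Hansen's inequality bounds it by `S f(Z) S`, the
  -- mean of `X'` and `Y`.
  set P := R * X * R with hPdef
  set C := matPow P (1 / 2) with hC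
  set C' := matPow P (-(1 / 2)) with hC'
  have hCH : C.IsHermitian := isHermitian_matPow P _
  have hC1 : C ≤ 1 := by
    rw [← Matrix.cfc_one_fun hP.isHermitian]
    refine Matrix.cfc_le_cfc fun x hx => ?_
    refine Real.rpow_le_one (hP.spectrum_pos hx).le ?_ (by norm_num)
    exact (Matrix.le_smul_one_iff (c := 1) hP.isHermitian).1 (by simpa using hP1) x hx
  set Z := R * Y * R with hZ
  have hZpsd : Z.PosSemidef := hY.mul_mul_of_isHermitian hRH
  set D := C' * Z * C' with hD
  have hDpsd : D.PosSemidef := hZpsd.mul_mul_of_isHermitian (isHermitian_matPow P _)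
  have hCDC : C * D * C = Z := matPow_half_conj_neg_half_conj hP Z
  have hSPS : S * P * S = X := matPow_half_conj_neg_half_conj hX' X
  have hSZS : S * Z * S = Y := matPow_half_conj_neg_half_conj hX' Y
  have hTT : (C * S)ᴴ * (C * S) = X := by
    rw [conjTranspose_mul, hCH.eq, hSH.eq, Matrix.mul_assoc, ← Matrix.mul_assoc C,
      matPow_half_mul_self hP, ← Matrix.mul_assoc, hSPS]
  have hTDT : (C * S)ᴴ * D * (C * S) = Y := by
    calc _ = S * (C * D * C) * S := by
          simp only [conjTranspose_mul, hCH.eq, hSH.eq, Matrix.mul_assoc]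
      _ = Y := by rw [hCDC, hSZS]
  have hTu : IsUnit (C * S) := (posDef_matPow hP _).isUnit.mul (posDef_matPow hX' _).isUnit
  have hmean := operatorMeanPos_conj (f := f) hTu hDpsd.isHermitian
  rw [hTT, hTDT] at hmean
  rw [hmean, operatorMeanPos, ← hS, ← hR]
  calc (C * S)ᴴ * cfc f D * (C * S) = S * (C * cfc f D * C) * S := by
        simp only [conjTranspose_mul, hCH.eq, hSH.eq, Matrix.mul_assoc]
    _ ≤ S * cfc f Z * S := by
      refine Matrix.mul_mul_le_of_isHermitian ?_ hSH
      rw [← hCDC]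
      exact hf.conj_cfc_le (posSemidef_matPow hP.posSemidef _) hC1 hDpsd
    _ ≤ _ := Matrix.mul_mul_le_of_isHermitian
      (hf.cfc_le_cfc hZpsd (Matrix.mul_mul_le_of_isHermitian hYY' hRH)) hSH

/-- Each quadratic form is monotone in `ε` and bounded below by `0`, hence converges; polarization
recovers the entries. -/
theorem Matrix.exists_tendsto_of_monotoneOn {ι : Type*} [Fintype ι] [DecidableEq ι]
    {G : ℝ → Matrix ι ι ℂ} (hG : MonotoneOn G (Set.Ioi 0))
    (hpos : ∀ ε, 0 < ε → (G ε).PosSemidef) : ∃ M, Tendsto G (𝓝[>] 0) (𝓝 M) := by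
  have hquad : ∀ v : ι → ℂ, ∃ L : ℂ,
      Tendsto (fun ε => star v ⬝ᵥ G ε *ᵥ v) (𝓝[>] 0) (𝓝 L) := by
    intro v
    have hmono : MonotoneOn (fun ε => (star v ⬝ᵥ G ε *ᵥ v).re) (Set.Ioi 0) := by
      intro a ha b hb hab
      have := (Matrix.le_iff.1 (hG ha hb hab)).dotProduct_mulVec_nonneg v
      simp only [Matrix.sub_mulVec, dotProduct_sub, sub_nonneg] at this
      exact (Complex.le_def.1 this).1
    have hb : BddBelow ((fun ε => (star v ⬝ᵥ G ε *ᵥ v).re) '' Set.Ioi 0) := by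
      refine ⟨0, ?_⟩
      rintro _ ⟨ε, hε, rfl⟩
      exact (Complex.le_def.1 ((hpos ε hε).dotProduct_mulVec_nonneg v)).1
    refine ⟨_, ((Complex.continuous_ofReal.tendsto _).comp (hmono.tendsto_nhdsGT hb)).congr' ?_⟩
    filter_upwards [self_mem_nhdsWithin] with ε hε
    have := (Complex.le_def.1 ((hpos ε hε).dotProduct_mulVec_nonneg v)).2
    exact Complex.ext (by simp) (by simpa using this)
  choose L hL using hquad
  have hpol : ∀ (M : Matrix ι ι ℂ) (x y : ι → ℂ), star x ⬝ᵥ M *ᵥ y =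
      (star (x + y) ⬝ᵥ M *ᵥ (x + y) - star (x - y) ⬝ᵥ M *ᵥ (x - y)
        - Complex.I * (star (x + Complex.I • y) ⬝ᵥ M *ᵥ (x + Complex.I • y))
        + Complex.I * (star (x - Complex.I • y) ⬝ᵥ M *ᵥ (x - Complex.I • y))) / 4 := by
    intro M x y
    simp only [star_add, star_sub, star_smul, Matrix.mulVec_add, Matrix.mulVec_sub,
      Matrix.mulVec_smul, dotProduct_add, dotProduct_sub, add_dotProduct, sub_dotProduct,
      smul_dotProduct, dotProduct_smul, smul_eq_mul, Complex.star_def, Complex.conj_I]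
    ring_nf
    simp only [Complex.I_sq]
    ring
  refine ⟨Matrix.of fun i j =>
    (L (Pi.single i 1 + Pi.single j 1) - L (Pi.single i 1 - Pi.single j 1)
      - Complex.I * L (Pi.single i 1 + Complex.I • Pi.single j 1)
      + Complex.I * L (Pi.single i 1 - Complex.I • Pi.single j 1)) / 4, ?_⟩
  refine tendsto_pi_nhds.2 fun i => tendsto_pi_nhds.2 fun j => ?_
  have hentry : ∀ ε, G ε i j =
      star (Pi.single i 1 : ι → ℂ) ⬝ᵥ G ε *ᵥ (Pi.single j 1 : ι → ℂ) := by
    intro ε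
    simp
  refine Tendsto.congr (fun ε => ((hentry ε).trans (hpol _ _ _)).symm) ?_
  exact ((((hL _).sub (hL _)).sub ((hL _).const_mul _)).add ((hL _).const_mul _)).div_const _

theorem operatorMeanReg_eq (X Y : Matrix (Fin l) (Fin l) ℂ) (ε : ℝ) :
    operatorMeanReg f X Y ε = operatorMeanPos f (X + ε • 1) (Y + ε • 1) := by
  have : (ε : ℂ) • (1 : Matrix (Fin l) (Fin l) ℂ) = ε • 1 := by ext; simp
  rw [operatorMeanReg, this]

theorem Matrix.PosSemidef.add_smul_one {X : Matrix (Fin l) (Fin l) ℂ} (hX : X.PosSemidef) {ε : ℝ}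
    (hε : 0 < ε) : (X + ε • (1 : Matrix (Fin l) (Fin l) ℂ)).PosDef := by
  rw [add_comm]
  exact (Matrix.PosDef.one.smul hε).add_posSemidef hX

theorem Matrix.add_smul_one_mono {X Y : Matrix (Fin l) (Fin l) ℂ} (h : X ≤ Y) {a b : ℝ}
    (hab : a ≤ b) : X + a • (1 : Matrix (Fin l) (Fin l) ℂ) ≤ Y + b • 1 := by
  refine add_le_add h ?_
  rw [Matrix.le_iff, ← sub_smul]
  exact Matrix.PosSemidef.one.smul (sub_nonneg.2 hab)

theorem IsOMPlusOne.operatorMeanReg_mono (hf : IsOMPlusOne f)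
    {X X' Y Y' : Matrix (Fin l) (Fin l) ℂ} (hX : X.PosSemidef) (hY : Y.PosSemidef)
    (hXX' : X ≤ X') (hYY' : Y ≤ Y') {a b : ℝ} (ha : 0 < a) (hab : a ≤ b) :
    operatorMeanReg f X Y a ≤ operatorMeanReg f X' Y' b := by
  rw [operatorMeanReg_eq, operatorMeanReg_eq]
  exact hf.operatorMeanPos_mono (hX.add_smul_one ha) (Matrix.add_smul_one_mono hXX' hab)
    (hY.add_smul_one ha).posSemidef (Matrix.add_smul_one_mono hYY' hab)

theorem IsOMPlusOne.posSemidef_operatorMeanReg (hf : IsOMPlusOne f)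
    {X Y : Matrix (Fin l) (Fin l) ℂ} (hY : Y.PosSemidef) {ε : ℝ} (hε : 0 < ε) :
    (operatorMeanReg f X Y ε).PosSemidef := by
  rw [operatorMeanReg_eq]
  exact hf.posSemidef_operatorMeanPos (hY.add_smul_one hε).posSemidef

theorem IsOMPlusOne.operatorMeanConverges (hf : IsOMPlusOne f)
    {X Y : Matrix (Fin l) (Fin l) ℂ} (hX : X.PosSemidef) (hY : Y.PosSemidef) :
    OperatorMeanConverges f X Y := by
  obtain ⟨M, hM⟩ := Matrix.exists_tendsto_of_monotoneOn (G := operatorMeanReg f X Y)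
    (fun a ha b _ hab => hf.operatorMeanReg_mono hX hY le_rfl le_rfl ha hab)
    (fun ε hε => hf.posSemidef_operatorMeanReg hY hε)
  rw [OperatorMeanConverges, operatorMean, hM.limUnder_eq]
  exact hM

theorem IsOMPlusOne.posSemidef_operatorMean (hf : IsOMPlusOne f)
    {X Y : Matrix (Fin l) (Fin l) ℂ} (hX : X.PosSemidef) (hY : Y.PosSemidef) :
    (operatorMean f X Y).PosSemidef :=
  Matrix.isClosed_posSemidef.mem_of_tendsto (hf.operatorMeanConverges hX hY) (by
    filter_upwards [self_mem_nhdsWithin] with ε hε using hf.posSemidef_operatorMeanReg hY hε)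

/-- The regularized means decrease to their limit, which is thus their infimum. Lower bounds can
then be checked at each `ε`. -/
theorem IsOMPlusOne.le_operatorMean_iff (hf : IsOMPlusOne f)
    {X Y M : Matrix (Fin l) (Fin l) ℂ} (hX : X.PosSemidef) (hY : Y.PosSemidef) :
    M ≤ operatorMean f X Y ↔ ∀ ε : ℝ, 0 < ε → M ≤ operatorMeanReg f X Y ε := by
  have hconv := hf.operatorMeanConverges hX hY
  constructor
  · intro h ε hε
    refine h.trans ?_
    rw [Matrix.le_iff]
    refine Matrix.isClosed_posSemidef.mem_of_tendsto (tendsto_const_nhds.sub hconv) ?_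
    filter_upwards [Ioc_mem_nhdsGT hε] with δ hδ
    exact Matrix.le_iff.1 (hf.operatorMeanReg_mono hX hY le_rfl le_rfl hδ.1 hδ.2)
  · intro h
    rw [Matrix.le_iff]
    refine Matrix.isClosed_posSemidef.mem_of_tendsto (hconv.sub tendsto_const_nhds) ?_
    filter_upwards [self_mem_nhdsWithin] with δ hδ using Matrix.le_iff.1 (h δ hδ)

end OperatorMean

/-! ### An Ando–Hiai inequality -/

section AndoHiai

open Matrix
open scoped MatrixOrder

variable {l : ℕ} {f : ℝ → ℝ}

/-- For `C = X^(-1/2) Y X^(-1/2)` the hypothesis says `X⁻¹ ≤ f(C)`. The inversion is done by passing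
from `V* V ≤ 1` to `V V* ≤ 1` for `V = X^(-1/2) f(C)^(-1/2)`. -/
theorem IsOMPlusOne.cfc_inv_le_of_one_le_operatorMeanPos (hf : IsOMPlusOne f)
    {X Y : Matrix (Fin l) (Fin l) ℂ} (hX : X.PosDef) (hY : Y.PosDef)
    (h : 1 ≤ operatorMeanPos f X Y) :
    cfc (fun x => (f x)⁻¹) (matPow X (-(1 / 2)) * Y * matPow X (-(1 / 2))) ≤ X := by
  set S := matPow X (1 / 2) with hS
  set R := matPow X (-(1 / 2)) with hR
  have hSH : S.IsHermitian := isHermitian_matPow X _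
  have hRH : R.IsHermitian := isHermitian_matPow X _
  have hSS : S * S = X := matPow_half_mul_self hX
  have hSR : S * R = 1 := matPow_half_mul_neg_half hX
  have hRS : R * S = 1 := matPow_neg_half_mul_half hX
  have hRu : IsUnit R := (posDef_matPow hX _).isUnit
  set C := R * Y * R with hC
  have hCpd : C.PosDef :=
    (hY.posSemidef.mul_mul_of_isHermitian hRH).posDef_iff_isUnit.2
      ((hRu.mul hY.isUnit).mul hRu)
  have hRR : R * R ≤ cfc f C := by
    have h1 := Matrix.mul_mul_le_of_isHermitian h hRH
    rw [Matrix.mul_one] at h1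
    refine h1.trans_eq ?_
    calc R * (S * cfc f C * S) * R = (R * S) * cfc f C * (S * R) := by
          simp only [Matrix.mul_assoc]
      _ = _ := by rw [hRS, hSR, Matrix.one_mul, Matrix.mul_one]
  set G := cfc (fun x => (√(f x))⁻¹) C with hG
  have hGH : G.IsHermitian := Matrix.isHermitian_cfc _ _
  have hGFG : G * cfc f C * G = 1 := by
    rw [hG, Matrix.cfc_mul_cfc, Matrix.cfc_mul_cfc, ← Matrix.cfc_one_fun hCpd.isHermitian]
    refine cfc_congr fun x hx => ?_
    have hfx := hf.pos (hCpd.spectrum_pos hx)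
    have hne : √(f x) ≠ 0 := (Real.sqrt_pos.2 hfx).ne'
    have hsq : √(f x) * √(f x) = f x := Real.mul_self_sqrt hfx.le
    field_simp
    rw [sq, hsq]
  have hGG : G * G = cfc (fun x => (f x)⁻¹) C := by
    rw [hG, Matrix.cfc_mul_cfc]
    refine cfc_congr fun x hx => ?_
    rw [← mul_inv, Real.mul_self_sqrt (hf.pos (hCpd.spectrum_pos hx)).le]
  have hV : (R * G)ᴴ * (R * G) ≤ (1 : ℝ) • 1 := by
    calc (R * G)ᴴ * (R * G) = G * (R * R) * G := by
          simp only [conjTranspose_mul, hRH.eq, hGH.eq, Matrix.mul_assoc]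
      _ ≤ G * cfc f C * G := Matrix.mul_mul_le_of_isHermitian hRR hGH
      _ = (1 : ℝ) • 1 := by rw [hGFG, one_smul]
  have hV' := Matrix.mul_mul_le_of_isHermitian
    (Matrix.mul_conjTranspose_le_smul_one one_pos hV) hSH
  rw [one_smul, Matrix.mul_one, hSS] at hV'
  refine le_trans (le_of_eq ?_) hV'
  calc cfc (fun x => (f x)⁻¹) C = (S * R) * (G * G) * (R * S) := by
        rw [hSR, hRS, hGG, Matrix.one_mul, Matrix.mul_one]
    _ = _ := by simp only [conjTranspose_mul, hRH.eq, hGH.eq, Matrix.mul_assoc]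

/-- An Ando–Hiai inequality for exponents in `[1, 2]`. -/
theorem IsOMPlusOne.one_le_operatorMeanPos_matPow (hf : IsOMPlusOne f)
    (hfr : ∀ x : ℝ, 0 ≤ x → ∀ r : ℝ, 1 ≤ r → f x ^ r ≤ f (x ^ r))
    {X Y : Matrix (Fin l) (Fin l) ℂ} (hX : X.PosDef) (hY : Y.PosDef)
    (h : 1 ≤ operatorMeanPos f X Y) {r : ℝ} (hr : 1 ≤ r) (hr2 : r ≤ 2) :
    1 ≤ operatorMeanPos f (matPow X r) (matPow Y r) := by
  have hFX := hf.cfc_inv_le_of_one_le_operatorMeanPos hX hY h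
  set S := matPow X (1 / 2) with hS
  set R := matPow X (-(1 / 2)) with hR
  have hSH : S.IsHermitian := isHermitian_matPow X _
  have hRH : R.IsHermitian := isHermitian_matPow X _
  have hSS : S * S = X := matPow_half_mul_self hX
  have hRu : IsUnit R := (posDef_matPow hX _).isUnit
  set C := R * Y * R with hC
  have hCpd : C.PosDef :=
    (hY.posSemidef.mul_mul_of_isHermitian hRH).posDef_iff_isUnit.2
      ((hRu.mul hY.isUnit).mul hRu)
  have hSCS : S * C * S = Y := matPow_half_conj_neg_half_conj hX Y
  have hp : r - 1 ∈ Set.Icc (0 : ℝ) 1 := ⟨by linarith, by linarith⟩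
  set H : ℝ → ℝ := fun x => ((f x)⁻¹) ^ (r - 1) with hH
  have hHpos : ∀ x, 0 < x → 0 < H x := fun x hx =>
    Real.rpow_pos_of_pos (inv_pos.2 (hf.pos hx)) _
  have hFpsd : (cfc (fun x => (f x)⁻¹) C).PosSemidef :=
    Matrix.posSemidef_cfc fun x hx => (inv_pos.2 (hf.pos (hCpd.spectrum_pos hx))).le
  -- `X^r = S X^(r-1) S`, and Löwner–Heinz raises `f(C)⁻¹ ≤ X` to the power `r - 1 ≤ 1`.
  have hXr : S * cfc H C * S ≤ matPow X r := by
    have h1 := Matrix.cfc_rpow_conjTranspose_mul_self S hr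
    rw [hSH.eq, hSS] at h1
    rw [matPow, h1]
    refine Matrix.mul_mul_le_of_isHermitian ?_ hSH
    have h2 := Matrix.cfc_rpow_le_cfc_rpow hFpsd hFX hp
    rwa [Matrix.cfc_cfc _ _ hCpd.isHermitian] at h2
  set Q := matPow C (1 / 2) with hQ
  have hQH : Q.IsHermitian := isHermitian_matPow C _
  have hQQ : Q * Q = C := matPow_half_mul_self hCpd
  -- Likewise with `Y = (Q S)* (Q S)`: the inner matrix is now `Q X Q ≥ C f(C)⁻¹`.
  have hYr : S * cfc (fun x => x ^ r * H x) C * S ≤ matPow Y r := by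
    have h1 := Matrix.cfc_rpow_conjTranspose_mul_self (Q * S) hr
    have e1 : (Q * S)ᴴ * (Q * S) = Y := by
      rw [conjTranspose_mul, hQH.eq, hSH.eq, Matrix.mul_assoc, ← Matrix.mul_assoc Q, hQQ,
        ← Matrix.mul_assoc, hSCS]
    have e2 : (Q * S) * (Q * S)ᴴ = Q * X * Q := by
      rw [conjTranspose_mul, hQH.eq, hSH.eq, ← hSS]
      simp only [Matrix.mul_assoc]
    rw [e1, e2] at h1
    have e3 : Q * cfc (fun x => (f x)⁻¹) C * Q = cfc (fun x => x * (f x)⁻¹) C := by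
      rw [hQ, matPow, Matrix.cfc_mul_cfc, Matrix.cfc_mul_cfc]
      refine cfc_congr fun x hx => ?_
      have hx0 := hCpd.spectrum_pos hx
      have : x ^ (1 / 2 : ℝ) * x ^ (1 / 2 : ℝ) = x := by
        rw [← Real.rpow_add hx0]; norm_num
      rw [mul_right_comm, this]
    have h2 := Matrix.mul_mul_le_of_isHermitian hFX hQH
    rw [e3] at h2
    have h3 := Matrix.cfc_rpow_le_cfc_rpow (Matrix.posSemidef_cfc fun x hx =>
      (mul_pos (hCpd.spectrum_pos hx) (inv_pos.2 (hf.pos (hCpd.spectrum_pos hx)))).le) h2 hp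
    rw [Matrix.cfc_cfc _ _ hCpd.isHermitian] at h3
    have h4 := Matrix.conjTranspose_mul_mul_le h3 (Q * S)
    rw [← h1] at h4
    refine le_trans (le_of_eq ?_) h4
    have e4 : Q * cfc (fun x => (x * (f x)⁻¹) ^ (r - 1)) C * Q
        = cfc (fun x => x ^ r * H x) C := by
      rw [hQ, matPow, Matrix.cfc_mul_cfc, Matrix.cfc_mul_cfc]
      refine cfc_congr fun x hx => ?_
      have hx0 := hCpd.spectrum_pos hx
      have : x ^ (1 / 2 : ℝ) * x ^ (1 / 2 : ℝ) = x := by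
        rw [← Real.rpow_add hx0]; norm_num
      simp only [hH]
      rw [mul_right_comm, this, Real.mul_rpow hx0.le (inv_pos.2 (hf.pos hx0)).le, ← mul_assoc,
        ← Real.rpow_eq_mul_rpow_sub_one hx0.le hr]
    rw [← e4]
    simp only [conjTranspose_mul, hQH.eq, hSH.eq, Matrix.mul_assoc]
  -- Both lower bounds share the factor `T = E S`: they are `T* T` and `T* C^r T`, so their mean is
  -- exactly `S f(C^r) H(C) S`.
  set E := cfc (fun x => √(H x)) C with hE
  have hEH : E.IsHermitian := Matrix.isHermitian_cfc _ _
  have hEu : IsUnit E :=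
    (Matrix.posDef_cfc hCpd.isHermitian fun x hx =>
      Real.sqrt_pos.2 (hHpos x (hCpd.spectrum_pos hx))).isUnit
  have hSu : IsUnit S := (posDef_matPow hX _).isUnit
  have hEgE : ∀ g : ℝ → ℝ, (E * S)ᴴ * cfc g C * (E * S)
      = S * cfc (fun x => g x * H x) C * S := by
    intro g
    have : E * cfc g C * E = cfc (fun x => g x * H x) C := by
      rw [hE, Matrix.cfc_mul_cfc, Matrix.cfc_mul_cfc]
      refine cfc_congr fun x hx => ?_
      rw [mul_right_comm, Real.mul_self_sqrt (hHpos x (hCpd.spectrum_pos hx)).le, mul_comm]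
    rw [← this]
    simp only [conjTranspose_mul, hEH.eq, hSH.eq, Matrix.mul_assoc]
  have hEE : (E * S)ᴴ * (E * S) = S * cfc H C * S := by
    have := hEgE (fun _ => 1)
    rwa [Matrix.cfc_one_fun hCpd.isHermitian, Matrix.mul_one, funext fun x => one_mul (H x)]
      at this
  have hmean := operatorMeanPos_conj (f := f) (T := E * S) (Z := cfc (fun x : ℝ => x ^ r) C)
    (hEu.mul hSu) (Matrix.isHermitian_cfc _ _)
  rw [hEE, hEgE, Matrix.cfc_cfc _ _ hCpd.isHermitian, hEgE] at hmean
  have hSHS : (S * cfc H C * S).PosDef := by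
    rw [← hEE]
    exact (posSemidef_conjTranspose_mul_self _).posDef_iff_isUnit.2
      ((hEu.mul hSu).star.mul (hEu.mul hSu))
  have hSrS : (S * cfc (fun x => x ^ r * H x) C * S).PosSemidef :=
    (Matrix.posSemidef_cfc fun x hx => mul_nonneg
      (Real.rpow_nonneg (hCpd.spectrum_pos hx).le _)
      (hHpos x (hCpd.spectrum_pos hx)).le).mul_mul_of_isHermitian hSH
  refine le_trans ?_ (hf.operatorMeanPos_mono hSHS hXr hSrS hYr)
  rw [hmean]
  -- What remains is scalar: `f(x^r) f(x)^(1-r) ≥ f(x)`, the hypothesis on `f`.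
  refine h.trans (Matrix.mul_mul_le_of_isHermitian (Matrix.cfc_le_cfc fun x hx => ?_) hSH)
  have hx0 := hCpd.spectrum_pos hx
  have hfx := hf.pos hx0
  calc f x = f x ^ r * H x := by
        simp only [hH]
        rw [Real.inv_rpow hfx.le, Real.rpow_eq_mul_rpow_sub_one hfx.le hr,
          mul_inv_cancel_right₀ (Real.rpow_pos_of_pos hfx _).ne']
    _ ≤ f (x ^ r) * H x := mul_le_mul_of_nonneg_right (hfr x hx0.le r hr) (hHpos x hx0).le

theorem matPow_smul {X : Matrix (Fin l) (Fin l) ℂ} (hX : X.PosSemidef) {c : ℝ} (hc : 0 ≤ c)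
    (r : ℝ) : matPow (c • X) r = c ^ r • matPow X r := by
  rw [matPow, Matrix.cfc_of_real_smul _ _ hX.isHermitian, matPow, ← Matrix.cfc_real_smul]
  exact cfc_congr fun x hx => Real.mul_rpow hc (hX.spectrum_nonneg hx)

theorem Matrix.real_smul_le_smul {X Y : Matrix (Fin l) (Fin l) ℂ} (h : X ≤ Y) {c : ℝ}
    (hc : 0 ≤ c) : c • X ≤ c • Y := by
  rw [Matrix.le_iff, ← smul_sub]
  exact (Matrix.le_iff.1 h).smul hc

theorem IsOMPlusOne.smul_one_le_operatorMeanPos_matPow (hf : IsOMPlusOne f)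
    (hfr : ∀ x : ℝ, 0 ≤ x → ∀ r : ℝ, 1 ≤ r → f x ^ r ≤ f (x ^ r))
    {X Y : Matrix (Fin l) (Fin l) ℂ} (hX : X.PosDef) (hY : Y.PosDef) {c : ℝ} (hc : 0 < c)
    (h : c • 1 ≤ operatorMeanPos f X Y) {r : ℝ} (hr : 1 ≤ r) (hr2 : r ≤ 2) :
    c ^ r • 1 ≤ operatorMeanPos f (matPow X r) (matPow Y r) := by
  have hc' : 0 < c⁻¹ := inv_pos.2 hc
  have h1 : 1 ≤ operatorMeanPos f (c⁻¹ • X) (c⁻¹ • Y) := by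
    rw [operatorMeanPos_smul hX hY.isHermitian hc']
    simpa [smul_smul, hc.ne'] using Matrix.real_smul_le_smul h hc'.le
  have h2 := hf.one_le_operatorMeanPos_matPow hfr (hX.smul hc') (hY.smul hc') h1 hr hr2
  rw [matPow_smul hX.posSemidef hc'.le, matPow_smul hY.posSemidef hc'.le,
    operatorMeanPos_smul (posDef_matPow hX r) (isHermitian_matPow Y r)
      (Real.rpow_pos_of_pos hc' r)] at h2
  have h3 := Matrix.real_smul_le_smul h2 (Real.rpow_nonneg hc.le r)
  rwa [smul_smul, Real.inv_rpow hc.le, mul_inv_cancel₀ (Real.rpow_pos_of_pos hc r).ne',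
    one_smul] at h3

end AndoHiai

/-! ### Jensen's inequality for positive maps -/

section Jensen

open Matrix
open scoped MatrixOrder

theorem Matrix.cfc_diagonal {ι : Type*} [Fintype ι] [DecidableEq ι] (f : ℝ → ℝ) (d : ι → ℝ) :
    cfc f (diagonal fun i => (d i : ℂ)) = diagonal fun i => (f (d i) : ℂ) := by
  have hH : (diagonal fun i => (d i : ℂ)).IsHermitian := by
    simp [Matrix.IsHermitian, diagonal_conjTranspose, Pi.star_def]
  obtain ⟨p, hp⟩ := Polynomial.exists_eval_eq_on_finite
    ((Matrix.finite_real_spectrum (A := diagonal fun i => (d i : ℂ))).union (Set.finite_range d)) f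
  rw [Matrix.cfc_eq_aeval hH fun x hx => hp x (Or.inl hx)]
  have h1 := Polynomial.aeval_algHom_apply (diagonalAlgHom (α := ℂ) (n := ι) ℝ)
    (fun i => (d i : ℂ)) p
  rw [diagonalAlgHom_apply, diagonalAlgHom_apply] at h1
  rw [h1]
  congr 1
  funext i
  have h2 := Polynomial.aeval_algHom_apply (Pi.evalAlgHom ℝ (fun _ : ι => ℂ) i)
    (fun i => (d i : ℂ)) p
  rw [Pi.evalAlgHom_apply, Pi.evalAlgHom_apply] at h2
  rw [← h2, ← hp (d i) (Or.inr ⟨i, rfl⟩)]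
  exact Polynomial.aeval_algebraMap_apply ℂ (d i) p

theorem Matrix.cfc_eq_sum_spectral {ι : Type*} [Fintype ι] [DecidableEq ι] (A : Matrix ι ι ℂ)
    {s : Finset ℝ} (hs : ∀ x ∈ spectrum ℝ A, x ∈ s) (g : ℝ → ℝ) :
    cfc g A = ∑ x : s, g x • cfc (fun y => if y = (x : ℝ) then 1 else 0) A := by
  rw [Finset.sum_coe_sort s fun x => g x • cfc (fun y => if y = x then (1 : ℝ) else 0) A]
  simp_rw [← Matrix.cfc_real_smul]
  rw [← cfc_sum _ _ _ fun i _ => continuousOn_real_spectrum _ _]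
  refine cfc_congr fun y hy => ?_
  simp [hs y hy]

variable {n l : ℕ}

theorem matPow_half_mul_self_of_posSemidef {X : Matrix (Fin l) (Fin l) ℂ} (hX : X.PosSemidef) :
    matPow X (1 / 2) * matPow X (1 / 2) = X := by
  rw [matPow, Matrix.cfc_mul_cfc]
  conv_rhs => rw [← Matrix.cfc_self hX.isHermitian]
  refine cfc_congr fun x hx => ?_
  simp only [← Real.sqrt_eq_rpow]
  exact Real.mul_self_sqrt (hX.spectrum_nonneg hx)

/-- A Jensen inequality for positive maps and the powers `x ^ r`, `1 ≤ r ≤ 2`. -/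
theorem IsPositiveMap.matPow_le
    {Φ : Matrix (Fin n) (Fin n) ℂ →ₗ[ℂ] Matrix (Fin l) (Fin l) ℂ} (hΦ : IsPositiveMap Φ)
    {K : ℝ} (hK : 0 < K) (hΦK : Φ 1 ≤ K • 1) {A : Matrix (Fin n) (Fin n) ℂ}
    (hA : A.PosSemidef) {r : ℝ} (hr : 1 ≤ r) (hr2 : r ≤ 2) :
    matPow (Φ A) r ≤ K ^ (r - 1) • Φ (matPow A r) := by
  have hp : r - 1 ∈ Set.Icc (0 : ℝ) 1 := ⟨by linarith, by linarith⟩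
  set s : Finset ℝ := (Matrix.finite_real_spectrum (A := A)).toFinset with hs
  have hs0 : ∀ x : s, (0 : ℝ) ≤ x := fun x =>
    hA.spectrum_nonneg ((Matrix.finite_real_spectrum (A := A)).mem_toFinset.1 x.2)
  set P : s → Matrix (Fin n) (Fin n) ℂ :=
    fun x => cfc (fun y => if y = (x : ℝ) then (1 : ℝ) else 0) A with hP
  have hPpsd : ∀ x, (Φ (P x)).PosSemidef := fun x =>
    hΦ _ (Matrix.posSemidef_cfc fun y _ => by split_ifs <;> simp)
  have hΦg : ∀ g : ℝ → ℝ, Φ (cfc g A) = ∑ x : s, g x • Φ (P x) := by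
    intro g
    rw [Matrix.cfc_eq_sum_spectral A (s := s) (by simp [hs]) g, map_sum]
    exact Finset.sum_congr rfl fun x _ => Φ.map_smul_of_tower _ _
  set Q : s → Matrix (Fin l) (Fin l) ℂ := fun x => matPow (Φ (P x)) (1 / 2) with hQ
  have hQQ : ∀ x, (Q x)ᴴ * Q x = Φ (P x) := by
    intro x
    rw [(isHermitian_matPow (Φ (P x)) (1 / 2)).eq]
    exact matPow_half_mul_self_of_posSemidef (hPpsd x)
  -- Stacking the roots `Φ(P x)^(1/2)` gives `Φ(g(A)) = V* D(g) V` for every `g`: on functions of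
  -- `A` alone, positivity of `Φ` already yields a Stinespring form.
  set V : Matrix (s × Fin l) (Fin l) ℂ := Matrix.of fun p b => Q p.1 p.2 b with hV
  set D : (ℝ → ℝ) → Matrix (s × Fin l) (s × Fin l) ℂ :=
    fun g => diagonal fun p => ((g p.1 : ℝ) : ℂ) with hD
  have hDmul : ∀ g h, D g * D h = D fun x => g x * h x := by
    intro g h
    simp [hD, diagonal_mul_diagonal]
  have hDH : ∀ g, (D g)ᴴ = D g := by
    intro g
    simp [hD, diagonal_conjTranspose, Pi.star_def]
  have hVDV : ∀ g : ℝ → ℝ, Vᴴ * D g * V = Φ (cfc g A) := by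
    intro g
    rw [hΦg]
    ext a b
    rw [Matrix.mul_apply]
    simp only [← hQQ, Matrix.sum_apply, Matrix.smul_apply, hD, Matrix.mul_diagonal]
    simp only [Matrix.mul_apply, hV, Fintype.sum_prod_type, conjTranspose_apply, of_apply,
      Finset.smul_sum, Complex.real_smul]
    exact Finset.sum_congr rfl fun x _ => Finset.sum_congr rfl fun c _ => by ring
  have hVV : Vᴴ * V ≤ K • 1 := by
    have h1 := hVDV fun _ => 1
    rw [Matrix.cfc_one_fun hA.isHermitian] at h1
    have : D (fun _ => 1) = 1 := by simp [hD]
    rw [this, Matrix.mul_one] at h1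
    rwa [h1]
  have hVV' := Matrix.mul_conjTranspose_le_smul_one hK hVV
  set E := D fun x => √x with hE
  have hEE : E * E = D fun x => x := by
    rw [hE, hDmul]
    simp only [hD]
    congr 1
    funext p
    rw [Real.mul_self_sqrt (hs0 p.1)]
  have hW1 : (E * V)ᴴ * (E * V) = Φ A := by
    have h1 := hVDV fun x => x
    rw [Matrix.cfc_self hA.isHermitian, ← hEE] at h1
    rw [← h1]
    simp only [conjTranspose_mul, hE, hDH, Matrix.mul_assoc]
  -- `Φ(A)^r = (E V)* (E V V* E)^(r-1) (E V)`, and `V V* ≤ K` replaces the inner matrix by a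
  -- diagonal one.
  have hW2 : (E * V) * (E * V)ᴴ ≤ D fun x => K * x := by
    have h1 := Matrix.conjTranspose_mul_mul_le hVV' E
    have e1 : Eᴴ * (K • 1) * E = D fun x => K * x := by
      rw [hE, hDH, ← hE, Matrix.mul_smul, Matrix.mul_one, Matrix.smul_mul, hEE]
      ext p q
      by_cases hpq : p = q <;> simp [hD, hpq]
    rw [e1] at h1
    refine le_trans (le_of_eq ?_) h1
    simp only [conjTranspose_mul, hE, hDH, Matrix.mul_assoc]
  have h1 := Matrix.cfc_rpow_le_cfc_rpow (posSemidef_self_mul_conjTranspose (E * V)) hW2 hp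
  have h2 : cfc (fun x : ℝ => x ^ (r - 1)) (D fun x => K * x) = D fun x => (K * x) ^ (r - 1) :=
    Matrix.cfc_diagonal (fun x : ℝ => x ^ (r - 1)) fun p : s × Fin l => K * (p.1 : ℝ)
  rw [h2] at h1
  have h3 := Matrix.conjTranspose_mul_mul_le h1 (E * V)
  rw [← Matrix.cfc_rpow_conjTranspose_mul_self (E * V) hr, hW1] at h3
  refine h3.trans_eq ?_
  have h4 : E * (D fun x => (K * x) ^ (r - 1)) * E = D fun x => K ^ (r - 1) * x ^ r := by
    rw [hE, hDmul (fun x => √x) (fun x => (K * x) ^ (r - 1)),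
      hDmul (fun x => √x * (K * x) ^ (r - 1)) fun x => √x]
    simp only [hD]
    congr 1
    funext p
    rw [mul_right_comm, Real.mul_self_sqrt (hs0 p.1), Real.mul_rpow hK.le (hs0 p.1),
      Real.rpow_eq_mul_rpow_sub_one (hs0 p.1) hr]
    congr 1
    ring
  calc (E * V)ᴴ * (D fun x => (K * x) ^ (r - 1)) * (E * V)
      = Vᴴ * (E * (D fun x => (K * x) ^ (r - 1)) * E) * V := by
        simp only [conjTranspose_mul, hE, hDH, Matrix.mul_assoc]
    _ = Φ (cfc (fun x => K ^ (r - 1) * x ^ r) A) := by rw [h4, hVDV (fun x => K ^ (r - 1) * x ^ r)]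
    _ = _ := by
      rw [Matrix.cfc_real_smul, matPow]
      exact Φ.map_smul_of_tower _ _

end Jensen

/-! ### Positive maps combined with means; all exponents `r ≥ 1` -/

section PositiveMapsAndMeans

open Matrix
open scoped MatrixOrder

variable {n m l : ℕ} {f : ℝ → ℝ}

theorem Matrix.cfc_add_real (c : ℝ) (g : ℝ → ℝ) {X : Matrix (Fin l) (Fin l) ℂ}
    (hX : X.IsHermitian) : cfc (fun x => g x + c) X = cfc g X + c • 1 := by
  rw [← Algebra.algebraMap_eq_smul_one]
  exact cfc_add_const c g X (continuousOn_real_spectrum _ _) hX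

theorem matPow_add_smul_one {X : Matrix (Fin l) (Fin l) ℂ} (hX : X.IsHermitian) (ε r : ℝ) :
    matPow (X + ε • 1) r = cfc (fun x : ℝ => (x + ε) ^ r) X := by
  have h : X + ε • 1 = cfc (fun x : ℝ => x + ε) X := by
    rw [Matrix.cfc_add_real ε (fun x => x) hX, Matrix.cfc_self hX]
  rw [h, matPow, Matrix.cfc_cfc _ _ hX]

theorem eventually_matPow_add_smul_one_le {X : Matrix (Fin l) (Fin l) ℂ} (hX : X.IsHermitian)
    {r η : ℝ} (hr : 0 ≤ r) (hη : 0 < η) :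
    ∀ᶠ ε in 𝓝[>] (0 : ℝ), matPow (X + ε • 1) r ≤ matPow X r + η • 1 := by
  have hev : ∀ᶠ ε in 𝓝[>] (0 : ℝ), ∀ x ∈ spectrum ℝ X, (x + ε) ^ r ≤ x ^ r + η := by
    rw [Filter.eventually_all_finite Matrix.finite_real_spectrum]
    intro x _
    have hc : Continuous fun ε : ℝ => (x + ε) ^ r :=
      (Real.continuous_rpow_const hr).comp (continuous_const.add continuous_id)
    have ht : Tendsto (fun ε : ℝ => (x + ε) ^ r) (𝓝[>] 0) (𝓝 (x ^ r)) := by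
      have := (hc.tendsto 0).mono_left (nhdsWithin_le_nhds (s := Set.Ioi 0))
      simpa using this
    exact (ht.eventually (gt_mem_nhds (show x ^ r < x ^ r + η by linarith))).mono
      fun _ h => h.le
  filter_upwards [hev] with ε hε
  rw [matPow_add_smul_one hX]
  refine (Matrix.cfc_le_cfc hε).trans_eq ?_
  rw [Matrix.cfc_add_real η (fun x : ℝ => x ^ r) hX, matPow]

theorem IsOMPlusOne.smul_one_le_operatorMean_of_le_two (hf : IsOMPlusOne f)
    (hfr : ∀ x : ℝ, 0 ≤ x → ∀ r : ℝ, 1 ≤ r → f x ^ r ≤ f (x ^ r))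
    {Φ : Matrix (Fin n) (Fin n) ℂ →ₗ[ℂ] Matrix (Fin l) (Fin l) ℂ} (hΦ : IsPositiveMap Φ)
    {Ψ : Matrix (Fin m) (Fin m) ℂ →ₗ[ℂ] Matrix (Fin l) (Fin l) ℂ} (hΨ : IsPositiveMap Ψ)
    {K : ℝ} (hK : 0 < K) (hΦK : Φ 1 ≤ K • 1) (hΨK : Ψ 1 ≤ K • 1)
    {A : Matrix (Fin n) (Fin n) ℂ} {B : Matrix (Fin m) (Fin m) ℂ}
    (hA : A.PosSemidef) (hB : B.PosSemidef) {r : ℝ} (hr : 1 ≤ r) (hr2 : r ≤ 2)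
    {c : ℝ} (hc : 0 < c) (h : c • 1 ≤ operatorMean f (Φ A) (Ψ B)) :
    (c ^ r / K ^ (r - 1)) • 1 ≤ operatorMean f (Φ (matPow A r)) (Ψ (matPow B r)) := by
  have hX := hΦ A hA
  have hY := hΨ B hB
  have hX' := hΦ _ (posSemidef_matPow hA r)
  have hY' := hΨ _ (posSemidef_matPow hB r)
  rw [hf.le_operatorMean_iff hX hY] at h
  rw [hf.le_operatorMean_iff hX' hY']
  intro η hη
  set k := K ^ (r - 1) with hk
  have hk0 : 0 < k := Real.rpow_pos_of_pos hK _
  have hr0 : 0 ≤ r := by linarith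
  -- The tolerance `k η` lets `k` factor out: `(Φ(A) + ε)^r ≤ Φ(A)^r + k η ≤ k (Φ(A^r) + η)`.
  obtain ⟨ε, ⟨hεX, hεY⟩, hε⟩ := (((eventually_matPow_add_smul_one_le hX.isHermitian hr0
    (mul_pos hk0 hη)).and (eventually_matPow_add_smul_one_le hY.isHermitian hr0
    (mul_pos hk0 hη))).and self_mem_nhdsWithin).exists
  have hε0 : 0 < ε := hε
  have h1 := h ε hε0
  rw [operatorMeanReg_eq] at h1
  have h2 := hf.smul_one_le_operatorMeanPos_matPow hfr (hX.add_smul_one hε0)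
    (hY.add_smul_one hε0) hc h1 hr hr2
  have hXle : matPow (Φ A + ε • 1) r ≤ k • (Φ (matPow A r) + η • 1) := by
    refine hεX.trans ?_
    rw [smul_add, smul_smul]
    exact Matrix.add_smul_one_mono (hΦ.matPow_le hK hΦK hA hr hr2) le_rfl
  have hYle : matPow (Ψ B + ε • 1) r ≤ k • (Ψ (matPow B r) + η • 1) := by
    refine hεY.trans ?_
    rw [smul_add, smul_smul]
    exact Matrix.add_smul_one_mono (hΨ.matPow_le hK hΨK hB hr hr2) le_rfl
  have h3 := h2.trans (hf.operatorMeanPos_mono (posDef_matPow (hX.add_smul_one hε0) r) hXle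
    (posSemidef_matPow (hY.add_smul_one hε0).posSemidef r) hYle)
  rw [operatorMeanPos_smul (hX'.add_smul_one hη) (hY'.add_smul_one hη).isHermitian hk0] at h3
  have h4 := Matrix.real_smul_le_smul h3 (inv_pos.2 hk0).le
  rw [smul_smul, smul_smul, inv_mul_cancel₀ hk0.ne', one_smul] at h4
  rwa [operatorMeanReg_eq, div_eq_inv_mul]

theorem IsOMPlusOne.smul_one_le_operatorMean (hf : IsOMPlusOne f)
    (hfr : ∀ x : ℝ, 0 ≤ x → ∀ r : ℝ, 1 ≤ r → f x ^ r ≤ f (x ^ r))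
    {Φ : Matrix (Fin n) (Fin n) ℂ →ₗ[ℂ] Matrix (Fin l) (Fin l) ℂ} (hΦ : IsPositiveMap Φ)
    {Ψ : Matrix (Fin m) (Fin m) ℂ →ₗ[ℂ] Matrix (Fin l) (Fin l) ℂ} (hΨ : IsPositiveMap Ψ)
    {K : ℝ} (hK : 0 < K) (hΦK : Φ 1 ≤ K • 1) (hΨK : Ψ 1 ≤ K • 1)
    {A : Matrix (Fin n) (Fin n) ℂ} {B : Matrix (Fin m) (Fin m) ℂ}
    (hA : A.PosSemidef) (hB : B.PosSemidef) {c : ℝ} (hc : 0 < c)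
    (h : c • 1 ≤ operatorMean f (Φ A) (Ψ B)) {r : ℝ} (hr : 1 ≤ r) :
    (c ^ r / K ^ (r - 1)) • 1 ≤ operatorMean f (Φ (matPow A r)) (Ψ (matPow B r)) := by
  have key : ∀ k : ℕ, ∀ r : ℝ, 1 ≤ r → r ≤ 2 ^ k →
      (c ^ r / K ^ (r - 1)) • 1 ≤ operatorMean f (Φ (matPow A r)) (Ψ (matPow B r)) := by
    intro k
    induction k with
    | zero =>
      intro r hr hrk
      exact hf.smul_one_le_operatorMean_of_le_two hfr hΦ hΨ hK hΦK hΨK hA hB hr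
        (by rw [pow_zero] at hrk; linarith) hc h
    | succ k ih =>
      intro r hr hrk
      rcases le_total r 2 with hr2 | hr2
      · exact hf.smul_one_le_operatorMean_of_le_two hfr hΦ hΨ hK hΦK hΨK hA hB hr hr2 hc h
      have h1 := ih (r / 2) (by linarith) (by rw [pow_succ] at hrk; linarith)
      have h2 := hf.smul_one_le_operatorMean_of_le_two hfr hΦ hΨ hK hΦK hΨK
        (posSemidef_matPow hA (r / 2)) (posSemidef_matPow hB (r / 2)) one_le_two le_rfl
        -- Exponent `r / 2` followed by `2`: the powers of `K` add up to `2 (r / 2 - 1) + 1 = r -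
        -- 1`.
        (div_pos (Real.rpow_pos_of_pos hc _) (Real.rpow_pos_of_pos hK _)) h1
      rw [matPow_matPow hA, matPow_matPow hB, div_mul_cancel₀ r two_ne_zero] at h2
      convert h2 using 2
      rw [Real.div_rpow (Real.rpow_nonneg hc.le _) (Real.rpow_nonneg hK.le _),
        ← Real.rpow_mul hc.le, ← Real.rpow_mul hK.le, div_div, ← Real.rpow_add hK]
      congr 2 <;> ring
  obtain ⟨k, hk⟩ := pow_unbounded_of_one_lt r one_lt_two
  exact key k r hr hk.le

theorem smul_one_le_iff_le_lastEigenvalue (hl : 0 < l) {X : Matrix (Fin l) (Fin l) ℂ}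
    (hX : X.IsHermitian) {c : ℝ} : c • 1 ≤ X ↔ c ≤ lastEigenvalue hl hX := by
  rw [Matrix.smul_one_le_iff hX, hX.spectrum_real_eq_range_eigenvalues, Set.forall_mem_range]
  constructor
  · intro h
    have := h ((Fintype.equivOfCardEq (Fintype.card_fin _))
      (Fin.cast (Fintype.card_fin l).symm ⟨l - 1, Nat.sub_lt hl Nat.one_pos⟩))
    simpa [Matrix.IsHermitian.eigenvalues, lastEigenvalue, eigenvalueDesc] using this
  · intro h i
    refine h.trans (hX.eigenvalues₀_antitone ?_)
    rw [Fin.le_def]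
    have := ((Fintype.equivOfCardEq (Fintype.card_fin (Fintype.card (Fin l)))).symm i).2
    simp only [Fintype.card_fin] at this
    exact Nat.le_sub_one_of_lt this

theorem le_opNorm_smul_one {X : Matrix (Fin l) (Fin l) ℂ} (hX : X.IsHermitian) :
    X ≤ opNorm X • 1 := by
  open scoped Matrix.Norms.L2Operator in
  have := IsSelfAdjoint.le_algebraMap_norm_self (a := X) hX
  rwa [Algebra.algebraMap_eq_smul_one] at this

end PositiveMapsAndMeans

/-! ### The eigenvalue inequality -/

open scoped MatrixOrder in
theorem proposition4p1 {n m l : ℕ} (hl : 0 < l)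
    (Φ : Matrix (Fin n) (Fin n) ℂ →ₗ[ℂ] Matrix (Fin l) (Fin l) ℂ)
    (Ψ : Matrix (Fin m) (Fin m) ℂ →ₗ[ℂ] Matrix (Fin l) (Fin l) ℂ)
    (hΦ : IsPositiveMap Φ) (hΨ : IsPositiveMap Ψ)
    (f : ℝ → ℝ) (hf : IsOMPlusOne f)
    (hfr : ∀ x : ℝ, 0 ≤ x → ∀ r : ℝ, 1 ≤ r → f x ^ r ≤ f (x ^ r))
    (A : Matrix (Fin n) (Fin n) ℂ) (B : Matrix (Fin m) (Fin m) ℂ)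
    (hA : A.PosSemidef) (hB : B.PosSemidef) (r : ℝ) (hr : 1 ≤ r) :
    OperatorMeanConverges f (Φ (matPow A r)) (Ψ (matPow B r)) ∧
    OperatorMeanConverges f (Φ A) (Ψ B) ∧
    ∃ (hS : (operatorMean f (Φ (matPow A r)) (Ψ (matPow B r))).PosSemidef)
      (hT : (operatorMean f (Φ A) (Ψ B)).PosSemidef),
      (lastEigenvalue hl hT.isHermitian) ^ r ≤
        (max (opNorm (Φ 1)) (opNorm (Ψ 1))) ^ (r - 1) *
          lastEigenvalue hl hS.isHermitian := by
  have hX' := hΦ _ (posSemidef_matPow hA r)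
  have hY' := hΨ _ (posSemidef_matPow hB r)
  have hS := hf.posSemidef_operatorMean hX' hY'
  have hT := hf.posSemidef_operatorMean (hΦ A hA) (hΨ B hB)
  refine ⟨hf.operatorMeanConverges hX' hY', hf.operatorMeanConverges (hΦ A hA) (hΨ B hB),
    hS, hT, ?_⟩
  set K := max (opNorm (Φ 1)) (opNorm (Ψ 1)) with hK
  have hK0 : 0 ≤ K := le_max_of_le_left (norm_nonneg _)
  have hS0 : 0 ≤ lastEigenvalue hl hS.isHermitian := by
    rw [← smul_one_le_iff_le_lastEigenvalue, zero_smul]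
    exact hS.nonneg
  have hT0 : 0 ≤ lastEigenvalue hl hT.isHermitian := by
    rw [← smul_one_le_iff_le_lastEigenvalue, zero_smul]
    exact hT.nonneg
  rcases hT0.eq_or_lt with hT0 | hT0
  · rw [← hT0, Real.zero_rpow (by linarith)]
    exact mul_nonneg (Real.rpow_nonneg hK0 _) hS0
  -- `K + δ` supplies the strictly positive bound needed above. Letting `δ → 0` is legitimate since
  -- `t ↦ t^(r-1)` is continuous for `r ≥ 1`; at `r = 1` it is constantly `1`, matching `0^0 = 1`.
  have key : ∀ δ : ℝ, 0 < δ → lastEigenvalue hl hT.isHermitian ^ r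
      ≤ (K + δ) ^ (r - 1) * lastEigenvalue hl hS.isHermitian := by
    intro δ hδ
    have hKδ : 0 < K + δ := by linarith
    have hle : ∀ X : Matrix (Fin l) (Fin l) ℂ, X.PosSemidef → opNorm X ≤ K →
        X ≤ (K + δ) • 1 := by
      intro X hX hXK
      refine (le_opNorm_smul_one hX.isHermitian).trans ?_
      rw [Matrix.le_iff, ← sub_smul]
      exact Matrix.PosSemidef.one.smul (by linarith)
    have h1 := hf.smul_one_le_operatorMean hfr hΦ hΨ hKδ
      (hle _ (hΦ 1 Matrix.PosSemidef.one) (le_max_left _ _))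
      (hle _ (hΨ 1 Matrix.PosSemidef.one) (le_max_right _ _)) hA hB hT0
      ((smul_one_le_iff_le_lastEigenvalue hl hT.isHermitian).2 le_rfl) hr
    rw [smul_one_le_iff_le_lastEigenvalue hl hS.isHermitian,
      div_le_iff₀ (Real.rpow_pos_of_pos hKδ _)] at h1
    linarith
  have hcont : Continuous fun δ : ℝ => (K + δ) ^ (r - 1) * lastEigenvalue hl hS.isHermitian :=
    ((Real.continuous_rpow_const (by linarith)).comp
      (continuous_const.add continuous_id)).mul continuous_const
  have hlim := (hcont.tendsto 0).mono_left (nhdsWithin_le_nhds (s := Set.Ioi 0))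
  rw [add_zero] at hlim
  exact ge_of_tendsto hlim (by filter_upwards [self_mem_nhdsWithin] with δ hδ using key δ hδ)
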